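/- **The $m$-rumor spreading model.** Fix integers $m\ge 1$, $r>m$, $s\ge m$ and a real number $d$ with $0<d\le 0.1$. A community consists of $N$ agents, where $r$ divides $N$: exactly $s$ of them are Seeds, exactly $bN$ are Agnostics, where $0\le b\le 0.25$, and the remaining $(1-b)N-s$ agents are Others. At each time every agent is either a Believer or Indifferent; Seeds are always Believers and Agnostics are always Indifferent. In each round $t=1,2,\dots$ the agents are placed by a uniformly random permutation into $N$ seats, which are divided into $N/r$ rooms of size $r$, and then simultaneously: an Other who is Indifferent becomes a Believer if its room holds at least $m$ Believers (and stays Indifferent otherwise), and an Other who is a Believer becomes Indifferent with probability $d$ (and stays a Believer otherwise). All permutations and all these random decisions are independent. Let $N_t$ be the number of Believers after round $t$; $N_0$ is the initial number. The rumor takes over at time $t$ if $N_t\ge N/2$, and it dies out at time $t$ if only the Seeds are Believers at time $t$. "A.a.s." means with probability $1-o(1)$ as $N\to\infty$ through multiples of $r$, where $m,r,s,d$ are constants and the $o(1)$ is uniform over $b\in[0,0.25]$ and over all initial sets of Believers that satisfy the stated condition. **Theorem 1.** Let $r$ and $d$ be as above. (i) Let $m=1$. There are constants $C,c>0$, depending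 only on $r$ and $d$, such that for every constant $s\ge 1$: if $N_0\ge s$, then a.a.s. the rumor takes over at some time $t\le C\log N$; and this is tight: if $N_0=s$, then a.a.s. the rumor does not take over at any time $t<c\log N$. (ii) Let $r\ge 3$. There are constants $\alpha,C,c>0$, depending only on $r$ and $d$, such that for all constants $2\le m<r$ and $s\ge m$: if $N_0\le\alpha N$, then a.a.s. the rumor dies out at some time $t\le C\log N$; and this is tight: for every constant $\beta>0$, if $N_0\ge\beta N$, then a.a.s. the rumor does not die out at any time $t<c\log N$. -/

import Mathlib

open MeasureTheory ProbabilityTheory Filter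

namespace RumorSpreading

/-- A community of `N` agents: some agents are Seeds, some are Agnostics, the remaining ones are
the Others. -/
structure Community (N : ℕ) where
  seeds : Finset (Fin N)
  agnostics : Finset (Fin N)
  disjoint_kinds : Disjoint seeds agnostics

/-- The agents that are neither Seeds nor Agnostics. -/
def Community.others {N : ℕ} (K : Community N) : Finset (Fin N) :=
  (K.seeds ∪ K.agnostics)ᶜ

/-- `B` is a possible set of Believers (all agents outside `B` are Indifferent): every Seed is a
Believer and no Agnostic is. -/
def Community.IsBelieverSet {N : ℕ} (K : Community N) (B : Finset (Fin N)) : Prop :=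
  K.seeds ⊆ B ∧ Disjoint B K.agnostics

/-- The room of agent `i` when agent `j` sits on seat `σ j`: the seats `0, …, N - 1` are grouped
into consecutive blocks of `r`, so that all rooms have exactly `r` seats when `r ∣ N`. -/
def room {N : ℕ} (r : ℕ) (σ : Equiv.Perm (Fin N)) (i : Fin N) : ℕ :=
  (σ i : ℕ) / r

/-- The number of members of `B` that are in the same room as `i`. -/
def believersInRoom {N : ℕ} (r : ℕ) (B : Finset (Fin N)) (σ : Equiv.Perm (Fin N)) (i : Fin N) : ℕ :=
  (B.filter fun j => room r σ j = room r σ i).card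

/-- The randomness of one round: the seating, and for each agent the outcome of a coin
(`true`: if the agent is an Other and a Believer, it loses interest in this round). -/
abbrev RoundOutcome (N : ℕ) : Type := Equiv.Perm (Fin N) × (Fin N → Bool)

/-- The set of Believers after one round that starts with the set `B` of Believers:
Seeds are Believers, Agnostics are not, a believing Other stays a Believer unless its coin shows
`true`, an indifferent Other becomes a Believer if its room holds at least `m` Believers. -/
def Community.nextBelievers {N : ℕ} (K : Community N) (m r : ℕ) (B : Finset (Fin N))
    (o : RoundOutcome N) : Finset (Fin N) :=
  K.seeds ∪ K.others.filter fun i =>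
    (i ∈ B ∧ o.2 i = false) ∨ (i ∉ B ∧ m ≤ believersInRoom r B o.1 i)

/-- The set of Believers after `t` rounds, starting from `B₀`; `ω t` is the randomness of round
`t + 1`. -/
def Community.believers {N : ℕ} (K : Community N) (m r : ℕ) (B₀ : Finset (Fin N))
    (ω : ℕ → RoundOutcome N) : ℕ → Finset (Fin N)
  | 0 => B₀
  | t + 1 => K.nextBelievers m r (K.believers m r B₀ ω t) (ω t)

/-- The rumor has taken over after `t` rounds: at least half of the community believes. -/
def Community.TakenOverAt {N : ℕ} (K : Community N) (m r : ℕ) (B₀ : Finset (Fin N))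
    (ω : ℕ → RoundOutcome N) (t : ℕ) : Prop :=
  (N : ℝ) / 2 ≤ ((K.believers m r B₀ ω t).card : ℝ)

/-- The rumor has died out after `t` rounds: only the Seeds believe. -/
def Community.DiedOutAt {N : ℕ} (K : Community N) (m r : ℕ) (B₀ : Finset (Fin N))
    (ω : ℕ → RoundOutcome N) (t : ℕ) : Prop :=
  K.believers m r B₀ ω t = K.seeds

instance instMeasurableSpacePerm (N : ℕ) : MeasurableSpace (Equiv.Perm (Fin N)) := ⊤

instance instDiscreteMeasurableSpacePerm (N : ℕ) :
    DiscreteMeasurableSpace (Equiv.Perm (Fin N)) := ⟨fun _ => trivial⟩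

/-- The law of one round: a uniformly random seating and independent coins showing `true` with
probability `d`, independent of the seating. -/
noncomputable def roundLaw (N : ℕ) (d : unitInterval) : Measure (RoundOutcome N) :=
  (PMF.uniformOfFintype (Equiv.Perm (Fin N))).toMeasure.prod
    (Measure.pi fun _ : Fin N => bernoulliMeasure true false d)

instance instIsProbabilityMeasureRoundLaw (N : ℕ) (d : unitInterval) :
    IsProbabilityMeasure (roundLaw N d) := by
  unfold roundLaw
  infer_instance

/-- The law of the whole process: independent rounds. -/
noncomputable def processLaw (N : ℕ) (d : unitInterval) : Measure (ℕ → RoundOutcome N) :=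
  Measure.infinitePi fun _ : ℕ => roundLaw N d

instance instIsProbabilityMeasureProcessLaw (N : ℕ) (d : unitInterval) :
    IsProbabilityMeasure (processLaw N d) := by
  unfold processLaw
  infer_instance

/-- An initial configuration of `N` agents that the model allows: rooms of size `r` fill up, there
are exactly `s` Seeds and `b * N` Agnostics for some `b ≤ 0.25`, and `B₀` is a possible set of
Believers. -/
structure IsAdmissible (r s : ℕ) (b : ℝ) {N : ℕ} (K : Community N) (B₀ : Finset (Fin N)) : Prop where
  rooms : r ∣ N
  card_seeds : K.seeds.card = s
  b_le : b ≤ 0.25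
  card_agnostics : (K.agnostics.card : ℝ) = b * N
  isBelieverSet : K.IsBelieverSet B₀

/-- An event holds asymptotically almost surely as `N → ∞`, for the process started with `N₀`
Believers for any `N₀` such that `init N N₀`: its probability is `1 - o(1)`, where the `o(1)` is
uniform over all admissible communities and initial sets of Believers. -/
def AAS (r s : ℕ) (d : unitInterval) (init : ℕ → ℕ → Prop)
    (event : ∀ {N : ℕ}, Community N → Finset (Fin N) → (ℕ → RoundOutcome N) → Prop) : Prop :=
  ∀ ε : ℝ, 0 < ε → ∀ᶠ N : ℕ in atTop,
    ∀ (b : ℝ) (K : Community N) (B₀ : Finset (Fin N)), IsAdmissible r s b K B₀ → init N B₀.card →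
      1 - ε ≤ (processLaw N d).real {ω | event K B₀ ω}

end RumorSpreading

/-
For `m = 1`, give each Believer a second seat in its own room; an indifferent Other on such a seat
is won over. The two seats are distinct, so before the take-over at least a quarter of the
Believers win a new one on average, which outweighs the losses to the coins: by convexity of
`x ↦ x⁻¹` the expected reciprocal of the number of Believers shrinks by a constant factor per
round, and Markov's inequality gives `O(log N)` rounds. Conversely, every round multiplies the
number of Believers by at most `r`.

For `m ≥ 2`, new Believers need a pair of Believers in the same room, and the expected number of
such pairs is at most `r * |B| ^ 2 / N`. As long as `|B| ≤ α * N` with `α` small, the expected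
number of believing Others therefore shrinks by the factor `1 - d / 2` per round. By Chebyshev's
inequality each round leaves this regime with probability `O(1 / N)` only, so a logarithmic number
of rounds is safe. Conversely, among linearly many initial Believers some keep their interest for
`Ω(log N)` rounds by their own coins alone.
-/

namespace RumorSpreading

section Chain

variable {S Ω : Type*}

/-- The state after `t` steps of the random dynamical system that starts in `x` and whose step
`t + 1` uses the randomness `ω t`; the abstract form of `Community.believers`. -/
def chain (step : S → Ω → S) (x : S) (ω : ℕ → Ω) : ℕ → S
  | 0 => x
  | t + 1 => step (chain step x ω t) (ω t)

theorem chain_succ_eq_shift (step : S → Ω → S) (x : S) (ω : ℕ → Ω) (t : ℕ) :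
    chain step x ω (t + 1) = chain step (step x (ω 0)) (fun i => ω (i + 1)) t := by
  induction t with
  | zero => rfl
  | succ t ih => rw [chain, ih]; rfl

theorem believers_eq_chain {N : ℕ} (K : Community N) (m r : ℕ) (B₀ : Finset (Fin N))
    (ω : ℕ → RoundOutcome N) (t : ℕ) :
    K.believers m r B₀ ω t = chain (K.nextBelievers m r) B₀ ω t := by
  induction t with
  | zero => rfl
  | succ t ih => rw [Community.believers, ih]; rfl

theorem chain_avoids_succ_iff {step : S → Ω → S} {D : Set S} {x : S} (hx : x ∉ D) (T : ℕ)
    (ω : ℕ → Ω) :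
    (∀ t ≤ T + 1, chain step x ω t ∉ D) ↔
      ∀ t ≤ T, chain step (step x (ω 0)) (fun i => ω (i + 1)) t ∉ D := by
  refine ⟨fun h t ht => ?_, fun h t ht => ?_⟩
  · rw [← chain_succ_eq_shift]
    exact h _ (by lia)
  · cases t with
    | zero => exact hx
    | succ t =>
      rw [chain_succ_eq_shift]
      exact h t (by lia)

variable [MeasurableSpace Ω]

theorem indepFun_head_tail (μ : Measure Ω) [IsProbabilityMeasure μ] :
    (fun ω : ℕ → Ω => ω 0) ⟂ᵢ[Measure.infinitePi fun _ : ℕ => μ] fun ω i => ω (i + 1) := by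
  have hcoord : iIndepFun (fun i (ω : ℕ → Ω) => ω i) (Measure.infinitePi fun _ : ℕ => μ) :=
    iIndepFun_infinitePi (X := fun _ ω => ω) fun _ => measurable_id
  have hblocks := indep_iSup_of_disjoint
    (fun i => (measurable_pi_apply (X := fun _ : ℕ => Ω) i).comap_le) hcoord.iIndep
    (S := {0}) (T := Set.range Nat.succ) (by simp)
  refine indep_of_indep_of_le_left (indep_of_indep_of_le_right hblocks ?_) ?_
  · rw [MeasurableSpace.comap_process_pi]
    exact iSup_le fun i => le_iSup₂_of_le (Nat.succ i) ⟨i, rfl⟩ le_rfl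
  · exact le_iSup₂_of_le 0 rfl le_rfl

theorem map_head_tail_infinitePi (μ : Measure Ω) [IsProbabilityMeasure μ] :
    (Measure.infinitePi fun _ : ℕ => μ).map (fun ω => (ω 0, fun i => ω (i + 1))) =
      μ.prod (Measure.infinitePi fun _ : ℕ => μ) := by
  rw [(indepFun_head_tail μ).map_prod_eq_prod_map_map
    (measurable_pi_apply 0).aemeasurable
    (measurable_pi_lambda _ fun i => measurable_pi_apply (i + 1)).aemeasurable,
    Measure.infinitePi_map_eval,
    Measure.map_infinitePi_infinitePi_of_inj (f := Nat.succ) Nat.succ_injective]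

variable [Finite Ω] [MeasurableSingletonClass Ω]

theorem measurable_chain [MeasurableSpace S] (step : S → Ω → S) (x : S) (t : ℕ) :
    Measurable fun ω : ℕ → Ω => chain step x ω t := by
  induction t generalizing x with
  | zero => exact measurable_const
  | succ t ih =>
    have hpair : Measurable fun p : Ω × (ℕ → Ω) => chain step (step x p.1) p.2 t :=
      measurable_from_prod_countable_right fun o => ih (step x o)
    simp only [chain_succ_eq_shift]
    exact hpair.comp (f := fun ω : ℕ → Ω => (ω 0, fun i => ω (i + 1))) (by fun_prop)

theorem measurableSet_chain_avoids (step : S → Ω → S) (D : Set S) (T : ℕ) (x : S) :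
    MeasurableSet {ω : ℕ → Ω | ∀ t ≤ T, chain step x ω t ∉ D} := by
  let : MeasurableSpace S := ⊤
  simp only [Set.ofPred_forall]
  exact .iInter fun t => .iInter fun _ =>
    measurable_chain step x t (show MeasurableSet Dᶜ from trivial)

theorem real_chain_avoids_succ (μ : Measure Ω) [IsProbabilityMeasure μ] (step : S → Ω → S)
    {D : Set S} {x : S} (hx : x ∉ D) (T : ℕ) :
    (Measure.infinitePi fun _ : ℕ => μ).real {ω | ∀ t ≤ T + 1, chain step x ω t ∉ D} =
      ∫ o, (Measure.infinitePi fun _ : ℕ => μ).real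
        {ω | ∀ t ≤ T, chain step (step x o) ω t ∉ D} ∂μ := by
  have hA : MeasurableSet {p : Ω × (ℕ → Ω) | ∀ t ≤ T, chain step (step x p.1) p.2 t ∉ D} :=
    measurableSet_setOfPred.2 <| measurable_from_prod_countable_right fun o =>
      measurableSet_setOfPred.1 (measurableSet_chain_avoids step D T (step x o))
  have hpre : {ω : ℕ → Ω | ∀ t ≤ T + 1, chain step x ω t ∉ D} =
      (fun ω => (ω 0, fun i => ω (i + 1))) ⁻¹'
        {p : Ω × (ℕ → Ω) | ∀ t ≤ T, chain step (step x p.1) p.2 t ∉ D} :=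
    Set.ext (chain_avoids_succ_iff hx T)
  rw [hpre, ← map_measureReal_apply (by fun_prop) hA, map_head_tail_infinitePi,
    measureReal_def, Measure.prod_apply hA]
  exact (integral_toReal (measurable_of_finite _).aemeasurable
    (.of_forall fun o => measure_lt_top _ _)).symm

omit [Finite Ω] [MeasurableSingletonClass Ω] in
theorem real_chain_avoids_of_mem (μ : Measure Ω) [IsProbabilityMeasure μ] (step : S → Ω → S)
    {D : Set S} (T : ℕ) {x : S} (hx : x ∈ D) :
    (Measure.infinitePi fun _ : ℕ => μ).real {ω | ∀ t ≤ T, chain step x ω t ∉ D} = 0 := by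
  have hempty : {ω : ℕ → Ω | ∀ t ≤ T, chain step x ω t ∉ D} = ∅ :=
    Set.eq_empty_of_forall_notMem fun ω h => h 0 (Nat.zero_le _) hx
  rw [hempty, measureReal_empty]

theorem real_chain_avoids_le (μ : Measure Ω) [IsProbabilityMeasure μ] {step : S → Ω → S}
    {D G : Set S} {φ : S → ℝ} {γ η : ℝ} (hγ : 0 ≤ γ) (hη : 0 ≤ η)
    (hφ : ∀ x, 0 ≤ φ x) (hφD : ∀ x ∈ G, x ∉ D → 1 ≤ φ x)
    (hdrift : ∀ x ∈ G, x ∉ D → ∫ o, φ (step x o) ∂μ ≤ γ * φ x)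
    (hexit : ∀ x ∈ G, x ∉ D → μ.real {o | step x o ∉ G} ≤ η) (T : ℕ) {x : S} (hx : x ∈ G) :
    (Measure.infinitePi fun _ : ℕ => μ).real {ω | ∀ t ≤ T, chain step x ω t ∉ D} ≤
      γ ^ T * φ x + T * η := by
  have hnonneg (T : ℕ) (x : S) : 0 ≤ γ ^ T * φ x + T * η := by
    have := hφ x
    positivity
  induction T generalizing x with
  | zero =>
    by_cases hD : x ∈ D
    · simpa [chain, hD] using hφ x
    · simpa [chain, hD] using hφD x hx hD
  | succ T ih =>
    by_cases hD : x ∈ D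
    · rw [real_chain_avoids_of_mem μ step (T + 1) hD]
      exact hnonneg _ _
    have hstep (o : Ω) : (Measure.infinitePi fun _ : ℕ => μ).real
        {ω | ∀ t ≤ T, chain step (step x o) ω t ∉ D} ≤
          γ ^ T * φ (step x o) + T * η + {o | step x o ∉ G}.indicator 1 o := by
      by_cases ho : step x o ∈ G
      · simpa [ho] using ih ho
      · have : ({o | step x o ∉ G}.indicator 1 o : ℝ) = 1 := by simp [ho]
        linarith [hnonneg T (step x o), measureReal_le_one (μ := Measure.infinitePi fun _ : ℕ => μ)
          (s := {ω | ∀ t ≤ T, chain step (step x o) ω t ∉ D})]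
    calc (Measure.infinitePi fun _ : ℕ => μ).real {ω | ∀ t ≤ T + 1, chain step x ω t ∉ D}
      _ ≤ ∫ o, (γ ^ T * φ (step x o) + T * η + {o | step x o ∉ G}.indicator 1 o) ∂μ := by
        rw [real_chain_avoids_succ μ step hD]
        exact integral_mono .of_finite .of_finite hstep
      _ = γ ^ T * ∫ o, φ (step x o) ∂μ + T * η + μ.real {o | step x o ∉ G} := by
        rw [integral_add .of_finite .of_finite, integral_add .of_finite .of_finite,
          integral_const_mul, integral_indicator_one (Set.toFinite _).measurableSet]
        simp
      _ ≤ γ ^ T * (γ * φ x) + T * η + η := by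
        gcongr
        exacts [hdrift x hx hD, hexit x hx hD]
      _ = γ ^ (T + 1) * φ x + (T + 1 : ℕ) * η := by
        push_cast
        ring

theorem one_sub_le_real_chain_hits (μ : Measure Ω) [IsProbabilityMeasure μ] {step : S → Ω → S}
    {D G : Set S} {φ : S → ℝ} {γ η : ℝ} (hγ : 0 ≤ γ) (hη : 0 ≤ η)
    (hφ : ∀ x, 0 ≤ φ x) (hφD : ∀ x ∈ G, x ∉ D → 1 ≤ φ x)
    (hdrift : ∀ x ∈ G, x ∉ D → ∫ o, φ (step x o) ∂μ ≤ γ * φ x)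
    (hexit : ∀ x ∈ G, x ∉ D → μ.real {o | step x o ∉ G} ≤ η) (T : ℕ) {x : S} (hx : x ∈ G) :
    1 - (γ ^ T * φ x + T * η) ≤
      (Measure.infinitePi fun _ : ℕ => μ).real {ω | ∃ t ≤ T, chain step x ω t ∈ D} := by
  have hcompl : {ω : ℕ → Ω | ∃ t ≤ T, chain step x ω t ∈ D} =
      {ω | ∀ t ≤ T, chain step x ω t ∉ D}ᶜ := by
    ext ω
    simp
  rw [hcompl, probReal_compl_eq_one_sub (measurableSet_chain_avoids step D T x)]
  exact sub_le_sub_left (real_chain_avoids_le μ hγ hη hφ hφD hdrift hexit T hx) 1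

end Chain

section LogTime

variable {x : ℝ}

theorem pow_floor_log_mul_le {γ : ℝ} (hγ : 0 ≤ γ) (hγ1 : γ < 1) (hx : 0 < x) :
    γ ^ ⌊2 / (1 - γ) * Real.log x⌋₊ * x ≤ Real.exp 1 / x := by
  have hγ1' : 0 < 1 - γ := sub_pos.2 hγ1
  set T := ⌊2 / (1 - γ) * Real.log x⌋₊
  have hT : 2 * Real.log x < (T + 1) * (1 - γ) := by
    have h := mul_lt_mul_of_pos_right (Nat.lt_floor_add_one (2 / (1 - γ) * Real.log x)) hγ1'
    rwa [mul_right_comm, div_mul_cancel₀ _ hγ1'.ne'] at h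
  calc γ ^ T * x
    _ ≤ Real.exp (-(1 - γ)) ^ T * x := by
      gcongr
      linarith [Real.add_one_le_exp (-(1 - γ))]
    _ = Real.exp (-(T * (1 - γ))) * x := by rw [← Real.exp_nat_mul, mul_neg]
    _ ≤ Real.exp (1 - Real.log x - Real.log x) * x := by
      gcongr
      linarith
    _ = Real.exp 1 / x := by
      rw [Real.exp_sub, Real.exp_sub, Real.exp_log hx, div_mul_cancel₀ _ hx.ne']

theorem inv_sqrt_le_pow_floor_log {q : ℝ} (hq : 0 < q) (hq1 : q < 1) (hx : 1 ≤ x) :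
    (√x)⁻¹ ≤ q ^ ⌊1 / (-2 * Real.log q) * Real.log x⌋₊ := by
  have hlogq : Real.log q < 0 := Real.log_neg hq hq1
  have hlogx : 0 ≤ Real.log x := Real.log_nonneg hx
  rw [← Real.log_le_log_iff (by positivity) (by positivity), Real.log_inv,
    Real.log_sqrt (by positivity), Real.log_pow]
  calc -(Real.log x / 2) = 1 / (-2 * Real.log q) * Real.log x * Real.log q := by
        have := hlogq.ne
        field_simp
    _ ≤ _ := by
        refine mul_le_mul_of_nonpos_right (Nat.floor_le ?_) hlogq.le
        exact mul_nonneg (one_div_nonneg.2 (by linarith)) hlogx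

theorem one_sub_le_real_chain_hits_log {S Ω : Type*} [MeasurableSpace Ω] [Finite Ω]
    [MeasurableSingletonClass Ω] (μ : Measure Ω) [IsProbabilityMeasure μ] {step : S → Ω → S}
    {D G : Set S} {φ : S → ℝ} {γ η : ℝ} (hγ : 0 ≤ γ) (hγ1 : γ < 1) (hη : 0 ≤ η)
    (hφ : ∀ y, 0 ≤ φ y) (hφD : ∀ y ∈ G, y ∉ D → 1 ≤ φ y)
    (hdrift : ∀ y ∈ G, y ∉ D → ∫ o, φ (step y o) ∂μ ≤ γ * φ y)
    (hexit : ∀ y ∈ G, y ∉ D → μ.real {o | step y o ∉ G} ≤ η) {y : S} (hy : y ∈ G)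
    (hx : 1 ≤ x) (hφx : φ y ≤ x) :
    1 - (Real.exp 1 / x + 2 / (1 - γ) * Real.log x * η) ≤
      (Measure.infinitePi fun _ : ℕ => μ).real
        {ω | ∃ t : ℕ, (t : ℝ) ≤ 2 / (1 - γ) * Real.log x ∧ chain step y ω t ∈ D} := by
  have hT : 0 ≤ 2 / (1 - γ) * Real.log x :=
    mul_nonneg (div_nonneg zero_le_two (sub_nonneg.2 hγ1.le)) (Real.log_nonneg hx)
  have hhits := one_sub_le_real_chain_hits μ hγ hη hφ hφD hdrift hexit
    ⌊2 / (1 - γ) * Real.log x⌋₊ hy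
  simp only [Nat.le_floor_iff hT] at hhits
  refine le_trans (sub_le_sub_left (add_le_add ?_ ?_) 1) hhits
  · exact (mul_le_mul_of_nonneg_left hφx (by positivity)).trans
      (pow_floor_log_mul_le hγ hγ1 (by linarith))
  · exact mul_le_mul_of_nonneg_right (Nat.floor_le hT) hη

end LogTime

section Moments

variable {Ω : Type*} [MeasurableSpace Ω] {μ : Measure Ω} [IsFiniteMeasure μ]

theorem real_ge_add_le_div_sq {X : Ω → ℝ} (hX : MemLp X 2 μ) {e v a : ℝ} (he : μ[X] ≤ e)
    (hv : Var[X; μ] ≤ v) (ha : 0 < a) : μ.real {ω | e + a ≤ X ω} ≤ v / a ^ 2 := by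
  have hsub : {ω | e + a ≤ X ω} ⊆ {ω | a ≤ |X ω - μ[X]|} := fun ω (hω : e + a ≤ X ω) =>
    le_trans (by linarith) (le_abs_self (X ω - μ[X]))
  calc μ.real {ω | e + a ≤ X ω}
    _ ≤ μ.real {ω | a ≤ |X ω - μ[X]|} := measureReal_mono hsub
    _ ≤ Var[X; μ] / a ^ 2 := ENNReal.toReal_le_of_le_ofReal
        (div_nonneg (variance_nonneg _ _) (sq_nonneg _)) (meas_ge_le_variance_div_sq hX ha)
    _ ≤ v / a ^ 2 := by gcongr

theorem integral_inv_one_add_eq_intervalIntegral_integral_pow [Finite Ω]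
    [MeasurableSingletonClass Ω] (X : Ω → ℕ) :
    ∫ ω, (1 + (X ω : ℝ))⁻¹ ∂μ = ∫ x in (0 : ℝ)..1, ∫ ω, x ^ X ω ∂μ := by
  have := Fintype.ofFinite Ω
  have hinv (n : ℕ) : ∫ x in (0 : ℝ)..1, x ^ n = (1 + (n : ℝ))⁻¹ := by
    simp [integral_pow, add_comm]
  simp only [integral_fintype .of_finite, smul_eq_mul]
  rw [intervalIntegral.integral_finsetSum fun ω _ => by
    apply Continuous.intervalIntegrable
    fun_prop]
  simp only [intervalIntegral.integral_const_mul, hinv]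

end Moments

section Coins

variable {ι : Type*}

/-- The law of independent coins, one for each `i : ι`, that show `true` with probability `d`. -/
noncomputable abbrev coinLaw (ι : Type*) [Fintype ι] (d : unitInterval) : Measure (ι → Bool) :=
  Measure.pi fun _ : ι => bernoulliMeasure true false d

/-- The members of `S` whose coin shows `false`: if `S` consists of believing Others, these are the
ones that stay Believers. -/
def survivors (S : Finset ι) (c : ι → Bool) : Finset ι :=
  S.filter fun i => c i = false

theorem survivors_subset (S : Finset ι) (c : ι → Bool) : survivors S c ⊆ S :=
  Finset.filter_subset _ _

theorem card_survivors_le (S : Finset ι) (c : ι → Bool) : (survivors S c).card ≤ S.card :=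
  Finset.card_le_card (survivors_subset S c)

variable [Fintype ι] (d : unitInterval) (S : Finset ι)

theorem integral_pow_card_survivors (x : ℝ) :
    ∫ c, x ^ (survivors S c).card ∂coinLaw ι d = (d + (1 - d) * x) ^ S.card := by
  classical
  have hprod (c : ι → Bool) : x ^ (survivors S c).card =
      ∏ i, if i ∈ S then (if c i = false then x else 1) else 1 := by
    rw [Finset.prod_ite_mem, Finset.univ_inter, Finset.prod_ite, Finset.prod_const_one, mul_one,
      Finset.prod_const, survivors]
  have hcoin (i : ι) : ∫ c, (if i ∈ S then (if c = false then x else 1) else 1)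
      ∂(bernoulliMeasure true false d) = if i ∈ S then (d + (1 - d) * x : ℝ) else 1 := by
    rw [integral_bernoulliMeasure]
    by_cases hi : i ∈ S <;> simp [hi]
  simp only [hprod]
  rw [integral_fintype_prod_eq_prod (μ := fun _ : ι => bernoulliMeasure true false d)
    (f := fun i (c : Bool) => if i ∈ S then (if c = false then x else 1) else (1 : ℝ))]
  simp only [hcoin]
  rw [Finset.prod_ite_mem, Finset.univ_inter, Finset.prod_const]

theorem intervalIntegral_affine_pow_le {p : ℝ} (hp : 0 ≤ p) (hp1 : p < 1) (n : ℕ) :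
    ∫ x in (0 : ℝ)..1, (p + (1 - p) * x) ^ n ≤ ((1 - p) * (n + 1))⁻¹ := by
  have hp' : 0 < 1 - p := by linarith
  rw [intervalIntegral.integral_comp_add_mul (fun x => x ^ n) hp'.ne', integral_pow, smul_eq_mul,
    mul_inv]
  refine mul_le_mul_of_nonneg_left ?_ (by positivity)
  rw [inv_eq_one_div]
  gcongr
  have : 0 ≤ (p + (1 - p) * 0) ^ (n + 1) := by simpa using pow_nonneg hp _
  have h1 : p + (1 - p) * 1 = 1 := by ring
  rw [h1, one_pow]
  linarith

theorem integral_inv_one_add_card_survivors_le (hd : (d : ℝ) < 1) :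
    ∫ c, (1 + ((survivors S c).card : ℝ))⁻¹ ∂coinLaw ι d ≤ ((1 - d : ℝ) * (S.card + 1))⁻¹ := by
  rw [integral_inv_one_add_eq_intervalIntegral_integral_pow]
  simp only [integral_pow_card_survivors]
  exact intervalIntegral_affine_pow_le d.2.1 hd S.card

theorem integral_card_survivors :
    ∫ c, ((survivors S c).card : ℝ) ∂coinLaw ι d = (1 - d : ℝ) * S.card := by
  classical
  have hcoin (i : ι) : ∫ c, (if c i = false then (1 : ℝ) else 0) ∂coinLaw ι d = 1 - d := by
    rw [integral_comp_eval (μ := fun _ : ι => bernoulliMeasure true false d)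
      (f := fun c => if c = false then (1 : ℝ) else 0)
      (measurable_of_finite _).aestronglyMeasurable, integral_bernoulliMeasure]
    simp
  simp only [survivors, Finset.natCast_card_filter]
  rw [integral_finsetSum _ fun _ _ => .of_finite]
  simp only [hcoin, Finset.sum_const, nsmul_eq_mul]
  ring

theorem variance_card_survivors_le :
    Var[fun c => ((survivors S c).card : ℝ); coinLaw ι d] ≤ S.card := by
  have hsum : (fun c => ((survivors S c).card : ℝ)) =
      ∑ i ∈ S, fun c : ι → Bool => if c i = false then (1 : ℝ) else 0 := by
    ext c
    simp only [survivors, Finset.natCast_card_filter, Finset.sum_apply]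
  have hindep : iIndepFun (fun i (c : ι → Bool) => if c i = false then (1 : ℝ) else 0)
      (coinLaw ι d) :=
    iIndepFun_pi (X := fun _ (c : Bool) => if c = false then (1 : ℝ) else 0)
      fun _ => (measurable_of_finite _).aemeasurable
  have hcoin (i : ι) : Var[fun c => if c i = false then (1 : ℝ) else 0; coinLaw ι d] ≤ 1 := by
    refine (variance_le_sq_of_bounded (a := 0) (b := 1) (.of_forall fun c => ?_)
      (measurable_of_finite _).aemeasurable).trans (by norm_num)
    split_ifs <;> simp
  rw [hsum, IndepFun.variance_sum (fun i _ => .of_discrete) fun i _ j _ hij => hindep.indepFun hij]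
  exact (Finset.sum_le_sum fun i _ => hcoin i).trans (by simp)

theorem real_le_card_survivors_le {a : ℝ} (ha : 0 < a) :
    (coinLaw ι d).real {c | (1 - d : ℝ) * S.card + a ≤ ((survivors S c).card : ℝ)} ≤
      S.card / a ^ 2 :=
  real_ge_add_le_div_sq .of_discrete (integral_card_survivors d S).le
    (variance_card_survivors_le d S) ha

end Coins

section Seating

/-- The law of a uniformly random seating. -/
noncomputable abbrev seatingLaw (N : ℕ) : Measure (Equiv.Perm (Fin N)) :=
  (PMF.uniformOfFintype (Equiv.Perm (Fin N))).toMeasure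

theorem roundLaw_eq (N : ℕ) (d : unitInterval) :
    roundLaw N d = (seatingLaw N).prod (coinLaw (Fin N) d) := rfl

/-- The probability that `l` given distinct seats are all taken by members of a given set of `k`
agents. -/
noncomputable def seatProb (N k l : ℕ) : ℝ := k.descFactorial l / N.descFactorial l

theorem seatProb_nonneg (N k l : ℕ) : 0 ≤ seatProb N k l := by
  unfold seatProb
  positivity

theorem seatProb_one (N k : ℕ) : seatProb N k 1 = k / N := by
  simp [seatProb]

theorem seatProb_succ (N k l : ℕ) :
    seatProb N k (l + 1) = seatProb N k l * ((k - l : ℕ) / (N - l : ℕ)) := by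
  simp only [seatProb, Nat.descFactorial_succ]
  push_cast
  rw [mul_comm, mul_comm ((N - l : ℕ) : ℝ), mul_div_mul_comm]

theorem natCast_sub_div_le_of_le {N k : ℕ} (hk : k ≤ N) {b c : ℕ} (hbc : b ≤ c) :
    ((k - c : ℕ) : ℝ) / (N - c : ℕ) ≤ (k - b : ℕ) / (N - b : ℕ) := by
  rcases Nat.le_total k c with hkc | hkc
  · rw [Nat.sub_eq_zero_of_le hkc, Nat.cast_zero, zero_div]
    positivity
  rcases (Nat.zero_le (N - c)).eq_or_lt with h0 | hpos
  · rw [← h0, Nat.cast_zero, div_zero]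
    positivity
  have hpos' : 0 < N - b := by lia
  rw [div_le_div_iff₀ (Nat.cast_pos.2 hpos) (Nat.cast_pos.2 hpos'), Nat.cast_sub hkc,
    Nat.cast_sub (hkc.trans hk), Nat.cast_sub (hbc.trans hkc),
    Nat.cast_sub ((hbc.trans hkc).trans hk)]
  linarith [mul_nonneg (sub_nonneg.2 (Nat.cast_le (α := ℝ).2 hbc))
    (sub_nonneg.2 (Nat.cast_le (α := ℝ).2 hk))]

-- Sampling without replacement: each further seat is less likely to be taken by a member.
theorem seatProb_add_le {N k : ℕ} (hk : k ≤ N) (a b : ℕ) :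
    seatProb N k (a + b) ≤ seatProb N k a * seatProb N k b := by
  induction b with
  | zero => simp [seatProb]
  | succ b ih =>
    rw [← add_assoc, seatProb_succ, seatProb_succ, ← mul_assoc]
    exact mul_le_mul ih (natCast_sub_div_le_of_le hk (Nat.le_add_left b a)) (by positivity)
      (mul_nonneg (seatProb_nonneg _ _ _) (seatProb_nonneg _ _ _))

variable {N : ℕ}

theorem integral_seatingLaw (Q : Equiv.Perm (Fin N) → ℝ) :
    ∫ σ, Q σ ∂seatingLaw N = (N.factorial : ℝ)⁻¹ * ∑ σ, Q σ := by
  rw [PMF.integral_eq_sum, Finset.mul_sum]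
  refine Finset.sum_congr rfl fun σ _ => ?_
  simp [PMF.uniformOfFintype_apply, Fintype.card_perm]

theorem integral_seatingLaw_embedding {ι : Type*} [Finite ι] (f : ι ↪ Fin N)
    (Q : (ι ↪ Fin N) → ℝ) [Fintype (ι ↪ Fin N)] :
    Fintype.card (ι ↪ Fin N) * ∫ σ, Q (f.trans σ.symm.toEmbedding) ∂seatingLaw N =
      ∑ g, Q g := by
  have hseats (g : ι ↪ Fin N) : ∑ σ : Equiv.Perm (Fin N), Q (f.trans σ.symm.toEmbedding) =
      ∑ σ : Equiv.Perm (Fin N), Q (g.trans σ.symm.toEmbedding) := by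
    obtain ⟨τ, hτ⟩ := Equiv.Perm.exists_extending_pair f g f.injective g.injective
    refine Fintype.sum_equiv (Equiv.mulLeft τ) _ _ fun σ => congrArg Q ?_
    ext i
    simp [← hτ, Equiv.Perm.mul_def]
  have hagents (σ : Equiv.Perm (Fin N)) :
      ∑ g : ι ↪ Fin N, Q (g.trans σ.symm.toEmbedding) = ∑ g : ι ↪ Fin N, Q g :=
    Fintype.sum_equiv (Equiv.embeddingCongr (Equiv.refl ι) σ.symm) _ _ fun _ => rfl
  have hcount : (Fintype.card (ι ↪ Fin N) : ℝ) *
      ∑ σ : Equiv.Perm (Fin N), Q (f.trans σ.symm.toEmbedding) = N.factorial * ∑ g, Q g :=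
    calc _ = ∑ g : ι ↪ Fin N, ∑ σ : Equiv.Perm (Fin N), Q (g.trans σ.symm.toEmbedding) := by
          simp only [← hseats, Finset.sum_const, Finset.card_univ, nsmul_eq_mul]
      _ = N.factorial * ∑ g, Q g := by
          rw [Finset.sum_comm]
          simp only [hagents, Finset.sum_const, Finset.card_univ, nsmul_eq_mul, Fintype.card_perm,
            Fintype.card_fin]
  have hN : (N.factorial : ℝ) ≠ 0 := by exact_mod_cast N.factorial_ne_zero
  rw [integral_seatingLaw, mul_left_comm, hcount, inv_mul_cancel_left₀ hN]

theorem descFactorial_mul_integral_seatingLaw_ite {l : ℕ} (f : Fin l ↪ Fin N)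
    (P : (Fin l ↪ Fin N) → Prop) [DecidablePred P] :
    (N.descFactorial l : ℝ) *
        ∫ σ, (if P (f.trans σ.symm.toEmbedding) then (1 : ℝ) else 0) ∂seatingLaw N =
      (Finset.univ.filter P).card := by
  have h := integral_seatingLaw_embedding f fun g => if P g then (1 : ℝ) else 0
  rwa [Fintype.card_embedding_eq, Fintype.card_fin, Fintype.card_fin, Finset.sum_boole] at h

theorem integral_seatingLaw_forall_mem {l : ℕ} (f : Fin l ↪ Fin N) (B : Finset (Fin N)) :
    ∫ σ, (if ∀ i, σ.symm (f i) ∈ B then (1 : ℝ) else 0) ∂seatingLaw N =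
      seatProb N B.card l := by
  have hN : (N.descFactorial l : ℝ) ≠ 0 := by
    have hl : l ≤ N := by simpa using Fintype.card_le_of_embedding f
    exact_mod_cast (Nat.descFactorial_pos.2 hl).ne'
  have hcard : (Finset.univ.filter fun g : Fin l ↪ Fin N => ∀ i, g i ∈ B).card =
      B.card.descFactorial l := by
    rw [← Fintype.card_subtype]
    refine (Fintype.card_congr (Equiv.codRestrict (Fin l) (B : Set (Fin N)))).trans ?_
    simp [Fintype.card_embedding_eq]
  rw [seatProb, eq_div_iff hN, mul_comm, ← hcard]
  exact descFactorial_mul_integral_seatingLaw_ite f fun g => ∀ i, g i ∈ B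

theorem integral_seatingLaw_mem_and_mem {p q : Fin N} (hpq : p ≠ q) {B I : Finset (Fin N)}
    (hBI : Disjoint B I) :
    (N * (N - 1) : ℝ) *
        ∫ σ, (if σ.symm p ∈ B ∧ σ.symm q ∈ I then (1 : ℝ) else 0) ∂seatingLaw N =
      B.card * I.card := by
  have hcard : (Finset.univ.filter fun g : Fin 2 ↪ Fin N => g 0 ∈ B ∧ g 1 ∈ I).card =
      (B ×ˢ I).card := by
    refine Finset.card_bij (fun g _ => (g 0, g 1)) (by simp) (fun g _ g' _ h => ?_) fun x hx => ?_
    · ext i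
      rw [Prod.mk.injEq] at h
      fin_cases i
      exacts [congrArg Fin.val h.1, congrArg Fin.val h.2]
    · rw [Finset.mem_product] at hx
      have hne : x.1 ≠ x.2 := hBI.forall_ne_finset hx.1 hx.2
      exact ⟨.embFinTwo hne, Finset.mem_filter.2 ⟨Finset.mem_univ _, hx⟩, rfl⟩
  rw [← Nat.cast_mul, ← Finset.card_product, ← hcard, ← Nat.cast_descFactorial_two]
  exact descFactorial_mul_integral_seatingLaw_ite (.embFinTwo hpq) fun g => g 0 ∈ B ∧ g 1 ∈ I

end Seating

section Rooms

variable {N r : ℕ}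

theorem card_seats_of_room_le (hr : 0 < r) (k : ℕ) :
    (Finset.univ.filter fun p : Fin N => (p : ℕ) / r = k).card ≤ r := by
  calc (Finset.univ.filter fun p : Fin N => (p : ℕ) / r = k).card
    _ ≤ (Finset.Ico (k * r) (k * r + r)).card := by
      refine Finset.card_le_card_of_injOn Fin.val (fun p hp => ?_) Fin.val_injective.injOn
      have hp : (p : ℕ) / r = k := by simpa using hp
      rw [Nat.div_eq_iff hr] at hp
      rw [Finset.mem_coe, Finset.mem_Ico]
      lia
    _ = r := by simp

theorem card_agents_of_room_le (hr : 0 < r) (σ : Equiv.Perm (Fin N)) (k : ℕ) :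
    (Finset.univ.filter fun i : Fin N => room r σ i = k).card ≤ r :=
  (Finset.card_le_card_of_injOn σ
    (fun _ hi => Finset.mem_filter.2 ⟨Finset.mem_univ _, (Finset.mem_filter.1 hi).2⟩)
    σ.injective.injOn).trans (card_seats_of_room_le hr k)

theorem exists_perm_ne_and_same_room (hr : 1 < r) (hrN : r ∣ N) :
    ∃ τ : Equiv.Perm (Fin N), ∀ p, τ p ≠ p ∧ (τ p : ℕ) / r = p / r := by
  obtain ⟨n, rfl⟩ := exists_eq_mul_left_of_dvd hrN
  obtain ⟨r, rfl⟩ : ∃ k, r = k + 2 := Nat.exists_eq_add_of_le' hr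
  refine ⟨finProdFinEquiv.permCongr ((Equiv.refl _).prodCongr (finRotate (r + 2))), fun p => ?_⟩
  obtain ⟨⟨k, x⟩, rfl⟩ := finProdFinEquiv.surjective p
  constructor
  · simp [finRotate_apply]
  · simp [Nat.add_mul_div_left, Nat.div_eq_of_lt (Fin.is_lt _)]

/-- The number of members of `B` for whom a member of `I` sits on the seat that `τ` assigns to
their own. -/
def contacts (τ : Equiv.Perm (Fin N)) (B I : Finset (Fin N)) (σ : Equiv.Perm (Fin N)) : ℕ :=
  (B.filter fun i => σ.symm (τ (σ i)) ∈ I).card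

theorem contacts_le_card (τ : Equiv.Perm (Fin N)) (B I : Finset (Fin N))
    (σ : Equiv.Perm (Fin N)) : contacts τ B I σ ≤ B.card :=
  Finset.card_filter_le _ _

theorem contacts_le_card_filter_one_le_believersInRoom {τ : Equiv.Perm (Fin N)}
    (hτ : ∀ p, (τ p : ℕ) / r = p / r) (B I : Finset (Fin N)) (σ : Equiv.Perm (Fin N)) :
    contacts τ B I σ ≤ (I.filter fun i => 1 ≤ believersInRoom r B σ i).card := by
  refine Finset.card_le_card_of_injOn (fun i => σ.symm (τ (σ i))) (fun i hi => ?_)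
    (σ.symm.injective.comp (τ.injective.comp σ.injective)).injOn
  obtain ⟨hiB, hiI⟩ := Finset.mem_filter.1 hi
  refine Finset.mem_filter.2 ⟨hiI, Finset.card_pos.2 ⟨i, Finset.mem_filter.2 ⟨hiB, ?_⟩⟩⟩
  simp only [room, Equiv.apply_symm_apply, hτ]

theorem integral_contacts {τ : Equiv.Perm (Fin N)} (hτ : ∀ p, τ p ≠ p) (hN : 0 < N)
    {B I : Finset (Fin N)} (hBI : Disjoint B I) :
    (N - 1 : ℝ) * ∫ σ, (contacts τ B I σ : ℝ) ∂seatingLaw N = B.card * I.card := by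
  have hsum (σ : Equiv.Perm (Fin N)) : (contacts τ B I σ : ℝ) =
      ∑ p, if σ.symm p ∈ B ∧ σ.symm (τ p) ∈ I then (1 : ℝ) else 0 := by
    rw [Finset.sum_boole, contacts]
    exact congrArg _ <| Finset.card_bij (fun i _ => σ i) (by simp) (by simp) fun p hp =>
      ⟨σ.symm p, by simpa using hp, by simp⟩
  have hN' : (N : ℝ) ≠ 0 := by positivity
  simp only [hsum]
  rw [integral_finsetSum _ fun _ _ => .of_finite]
  refine mul_left_cancel₀ hN' ?_
  rw [← mul_assoc, Finset.mul_sum]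
  simp only [integral_seatingLaw_mem_and_mem (hτ _).symm hBI, Finset.sum_const, Finset.card_univ,
    Fintype.card_fin, nsmul_eq_mul]

end Rooms

section NextBelievers

variable {N m r : ℕ} {K : Community N} {B : Finset (Fin N)}

theorem Community.isBelieverSet_nextBelievers (o : RoundOutcome N) :
    K.IsBelieverSet (K.nextBelievers m r B o) := by
  refine ⟨Finset.subset_union_left, Finset.disjoint_union_left.2 ⟨K.disjoint_kinds, ?_⟩⟩
  refine Disjoint.mono_left (Finset.filter_subset _ _) ?_
  exact disjoint_compl_left.mono_right Finset.subset_union_right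

theorem Community.IsBelieverSet.mem_others (h : K.IsBelieverSet B) {i : Fin N} (hi : i ∈ B)
    (his : i ∉ K.seeds) : i ∈ K.others := by
  simp [Community.others, his, Finset.disjoint_left.1 h.2 hi]

theorem Community.IsBelieverSet.survivors_subset_nextBelievers (h : K.IsBelieverSet B)
    (o : RoundOutcome N) : survivors B o.2 ⊆ K.nextBelievers m r B o := by
  intro i hi
  by_cases his : i ∈ K.seeds
  · exact Finset.mem_union_left _ his
  · have hi := Finset.mem_filter.1 hi
    exact Finset.mem_union_right _ (Finset.mem_filter.2 ⟨h.mem_others hi.1 his, Or.inl hi⟩)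

theorem Community.IsBelieverSet.card_others_sdiff (h : K.IsBelieverSet B) :
    (K.others \ B).card + B.card + K.agnostics.card = N := by
  have hcompl : K.others \ B = (B ∪ K.agnostics)ᶜ := by
    ext i
    have := @h.1 i
    simp only [Community.others, Finset.mem_sdiff, Finset.mem_compl, Finset.mem_union]
    tauto
  rw [hcompl, add_assoc, ← Finset.card_union_of_disjoint h.2, add_comm, Finset.card_add_card_compl,
    Fintype.card_fin]

theorem Community.IsBelieverSet.le_card_nextBelievers (h : K.IsBelieverSet B)
    {τ : Equiv.Perm (Fin N)} (hτ : ∀ p, (τ p : ℕ) / r = p / r) {i₀ : Fin N} (hi₀ : i₀ ∈ K.seeds)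
    (o : RoundOutcome N) :
    1 + (survivors (B.erase i₀) o.2).card + contacts τ B (K.others \ B) o.1 ≤
      (K.nextBelievers 1 r B o).card := by
  let old := insert i₀ (survivors (B.erase i₀) o.2)
  let new := (K.others \ B).filter fun i => 1 ≤ believersInRoom r B o.1 i
  have hold : old ⊆ K.nextBelievers 1 r B o := by
    refine Finset.insert_subset (Finset.mem_union_left _ hi₀) ?_
    exact (Finset.filter_subset_filter _ (Finset.erase_subset _ _)).trans
      (h.survivors_subset_nextBelievers o)
  have hnew : new ⊆ K.nextBelievers 1 r B o := by
    intro i hi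
    obtain ⟨hi, hbel⟩ := Finset.mem_filter.1 hi
    obtain ⟨hio, hiB⟩ := Finset.mem_sdiff.1 hi
    exact Finset.mem_union_right _ (Finset.mem_filter.2 ⟨hio, Or.inr ⟨hiB, hbel⟩⟩)
  have hdisj : Disjoint old new := by
    have holdB : old ⊆ B := Finset.insert_subset (h.1 hi₀)
      ((survivors_subset _ _).trans (Finset.erase_subset _ _))
    exact Finset.disjoint_sdiff.mono holdB (Finset.filter_subset _ _)
  have hi₀_notMem : i₀ ∉ survivors (B.erase i₀) o.2 := by simp [survivors]
  calc 1 + (survivors (B.erase i₀) o.2).card + contacts τ B (K.others \ B) o.1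
    _ ≤ old.card + new.card := by
      rw [Finset.card_insert_of_notMem hi₀_notMem, add_comm 1]
      exact Nat.add_le_add_left
        (contacts_le_card_filter_one_le_believersInRoom hτ B (K.others \ B) o.1) _
    _ ≤ _ := by
      rw [← Finset.card_union_of_disjoint hdisj]
      exact Finset.card_le_card (Finset.union_subset hold hnew)

theorem Community.IsBelieverSet.card_nextBelievers_le_mul (h : K.IsBelieverSet B) (hr : 0 < r)
    (hm : 1 ≤ m) (o : RoundOutcome N) : (K.nextBelievers m r B o).card ≤ B.card * r := by
  have hsub : K.nextBelievers m r B o ⊆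
      B.biUnion fun i => Finset.univ.filter fun j => room r o.1 j = room r o.1 i := by
    intro i hi
    rw [Finset.mem_biUnion]
    by_cases hiB : i ∈ B
    · exact ⟨i, hiB, by simp⟩
    have hroom : m ≤ believersInRoom r B o.1 i := by
      rcases Finset.mem_union.1 hi with his | hi
      · exact absurd (h.1 his) hiB
      · exact ((Finset.mem_filter.1 hi).2.resolve_left fun h => hiB h.1).2
    obtain ⟨j, hj⟩ := Finset.card_pos.1 (hm.trans hroom)
    exact ⟨j, (Finset.mem_filter.1 hj).1, by simp [(Finset.mem_filter.1 hj).2]⟩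
  exact (Finset.card_le_card hsub).trans
    (Finset.card_biUnion_le_card_mul _ _ _ fun i _ => card_agents_of_room_le hr _ _)

theorem Community.IsBelieverSet.believers {B₀ : Finset (Fin N)} (h : K.IsBelieverSet B₀)
    (ω : ℕ → RoundOutcome N) (t : ℕ) : K.IsBelieverSet (K.believers m r B₀ ω t) := by
  cases t with
  | zero => exact h
  | succ t => exact Community.isBelieverSet_nextBelievers (ω t)

theorem Community.IsBelieverSet.card_believers_le_mul_pow {B₀ : Finset (Fin N)}
    (h : K.IsBelieverSet B₀) (hr : 0 < r) (hm : 1 ≤ m) (ω : ℕ → RoundOutcome N) (t : ℕ) :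
    (K.believers m r B₀ ω t).card ≤ B₀.card * r ^ t := by
  induction t with
  | zero => simp [Community.believers]
  | succ t ih =>
    rw [pow_succ, ← mul_assoc]
    exact ((h.believers ω t).card_nextBelievers_le_mul hr hm (ω t)).trans
      (Nat.mul_le_mul_right r ih)

theorem Community.IsBelieverSet.chain_survivors_subset_believers {B₀ S : Finset (Fin N)}
    (h : K.IsBelieverSet B₀) (hS : S ⊆ B₀) (ω : ℕ → RoundOutcome N) (t : ℕ) :
    chain (fun S o => survivors S o.2) S ω t ⊆ K.believers m r B₀ ω t := by
  induction t with
  | zero => exact hS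
  | succ t ih =>
    exact (Finset.filter_subset_filter _ ih).trans
      ((h.believers ω t).survivors_subset_nextBelievers (ω t))

end NextBelievers

section Growth

theorem inv_convexCombination_le {x y t : ℝ} (hx : 0 < x) (hy : 0 < y) (ht : 0 ≤ t) (ht1 : t ≤ 1) :
    ((1 - t) * x + t * y)⁻¹ ≤ (1 - t) * x⁻¹ + t * y⁻¹ := by
  have h := (convexOn_zpow (𝕜 := ℝ) (-1)).2 (Set.mem_Ioi.2 hx) (Set.mem_Ioi.2 hy)
    (sub_nonneg.2 ht1) ht (sub_add_cancel 1 t)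
  simpa only [zpow_neg_one, smul_eq_mul] using h

-- Two convexity bounds: between `a` and `a + k`, then between `k` and `2 * k`.
theorem inv_add_le_interpolation {a j k : ℝ} (ha : 0 < a) (hak : a ≤ k) (hj : 0 ≤ j)
    (hjk : j ≤ k) :
    (a + j)⁻¹ ≤ (1 - j / k) * a⁻¹ + j / k * (k⁻¹ * (1 - a / (2 * k))) := by
  have hk : 0 < k := ha.trans_le hak
  have hsum : (a + k)⁻¹ ≤ k⁻¹ * (1 - a / (2 * k)) :=
    calc (a + k)⁻¹ = ((1 - a / k) * k + a / k * (2 * k))⁻¹ := by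
          congr 1
          field_simp
          ring
      _ ≤ (1 - a / k) * k⁻¹ + a / k * (2 * k)⁻¹ :=
          inv_convexCombination_le hk (by positivity) (by positivity) ((div_le_one hk).2 hak)
      _ = k⁻¹ * (1 - a / (2 * k)) := by
          field_simp
          ring
  calc (a + j)⁻¹ = ((1 - j / k) * a + j / k * (a + k))⁻¹ := by
        congr 1
        field_simp
        ring
    _ ≤ (1 - j / k) * a⁻¹ + j / k * (a + k)⁻¹ :=
        inv_convexCombination_le ha (by positivity) (by positivity) ((div_le_one hk).2 hjk)
    _ ≤ _ := by gcongr

variable {N r : ℕ} {K : Community N} {B : Finset (Fin N)}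

theorem Community.IsBelieverSet.inv_card_nextBelievers_le (h : K.IsBelieverSet B)
    {τ : Equiv.Perm (Fin N)} (hτ : ∀ p, (τ p : ℕ) / r = p / r) {i₀ : Fin N} (hi₀ : i₀ ∈ K.seeds)
    (o : RoundOutcome N) :
    ((K.nextBelievers 1 r B o).card : ℝ)⁻¹ ≤
      (1 - contacts τ B (K.others \ B) o.1 / B.card) *
          (1 + ((survivors (B.erase i₀) o.2).card : ℝ))⁻¹ +
        contacts τ B (K.others \ B) o.1 / B.card *
          ((B.card : ℝ)⁻¹ * (1 - (1 + (survivors (B.erase i₀) o.2).card) / (2 * B.card))) := by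
  have hsurv : 1 + (survivors (B.erase i₀) o.2).card ≤ B.card := by
    rw [add_comm, ← Finset.card_erase_add_one (h.1 hi₀)]
    exact Nat.add_le_add_right (card_survivors_le _ _) 1
  have hcontacts := contacts_le_card τ B (K.others \ B) o.1
  refine le_trans (inv_anti₀ (by positivity) ?_)
    (inv_add_le_interpolation (by positivity) (by exact_mod_cast hsurv) (Nat.cast_nonneg _)
      (by exact_mod_cast hcontacts))
  exact_mod_cast h.le_card_nextBelievers hτ hi₀ o

theorem Community.IsBelieverSet.integral_contacts_mem_Icc (h : K.IsBelieverSet B)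
    {τ : Equiv.Perm (Fin N)} (hτ : ∀ p, τ p ≠ p) (hne : B.Nonempty)
    (hA : (K.agnostics.card : ℝ) ≤ 0.25 * N) (hB : (B.card : ℝ) < N / 2) :
    (∫ σ, (contacts τ B (K.others \ B) σ : ℝ) ∂seatingLaw N) / B.card ∈ Set.Icc (1 / 4) 1 := by
  have hcard : (1 : ℝ) ≤ B.card := by exact_mod_cast hne.card_pos
  have hcard0 : (0 : ℝ) < B.card := by linarith
  have hmean := integral_contacts hτ (hne.choose.pos) (Finset.disjoint_sdiff (s := B)
    (t := K.others))
  have hindifferent : ((K.others \ B).card : ℝ) + B.card + K.agnostics.card = N := by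
    exact_mod_cast h.card_others_sdiff
  constructor
  · rw [le_div_iff₀ hcard0]
    refine le_of_mul_le_mul_left ?_ (show (0 : ℝ) < N - 1 by linarith)
    rw [hmean]
    nlinarith
  · rw [div_le_one hcard0]
    refine (integral_mono .of_finite .of_finite fun σ =>
      Nat.cast_le.2 (contacts_le_card τ B (K.others \ B) σ)).trans ?_
    simp

/-- The factor by which the expected reciprocal of the number of Believers shrinks in each round
before the rumor takes over, if one Believer in a room suffices. The coins alone multiply it by at
most `(1 - d)⁻¹`; the weight `1 / 4` bounds the expected number of contacts per Believer. -/
noncomputable def takeOverRate (d : ℝ) : ℝ := 3 / (4 * (1 - d)) + (1 + d) / 8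

theorem takeOverRate_nonneg (d : unitInterval) : 0 ≤ takeOverRate d := by
  have := d.2.1
  have : (0 : ℝ) ≤ 1 - d := sub_nonneg.2 d.2.2
  unfold takeOverRate
  positivity

theorem takeOverRate_lt_one {d : ℝ} (hd : d < 1) (hd8 : 8 * d < 1 + d ^ 2) :
    takeOverRate d < 1 := by
  have : 0 < 1 - d := by linarith
  rw [takeOverRate, ← lt_sub_iff_add_lt, div_lt_iff₀ (by positivity)]
  nlinarith

theorem one_sub_mul_inv_add_mul_le_takeOverRate {d μ : ℝ} (hd0 : 0 ≤ d) (hd1 : d < 1)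
    (hμ : 1 / 4 ≤ μ) : (1 - μ) * (1 - d)⁻¹ + μ * ((1 + d) / 2) ≤ takeOverRate d := by
  have hinv : 1 ≤ (1 - d)⁻¹ := (one_le_inv₀ (by linarith)).2 (by linarith)
  have hrate : takeOverRate d = 3 / 4 * (1 - d)⁻¹ + (1 + d) / 8 := by
    rw [takeOverRate, div_mul_eq_div_div]
    ring
  nlinarith

theorem Community.IsBelieverSet.integral_inv_card_nextBelievers_le (h : K.IsBelieverSet B)
    {d : unitInterval} (hd : (d : ℝ) < 1) (hr : 1 < r) (hrN : r ∣ N) (hK : K.seeds.Nonempty)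
    (hA : (K.agnostics.card : ℝ) ≤ 0.25 * N) (hB : (B.card : ℝ) < N / 2) :
    ∫ o, ((K.nextBelievers 1 r B o).card : ℝ)⁻¹ ∂roundLaw N d ≤
      takeOverRate d * (B.card : ℝ)⁻¹ := by
  obtain ⟨i₀, hi₀⟩ := hK
  obtain ⟨τ, hτ⟩ := exists_perm_ne_and_same_room hr hrN
  have herase : ((B.erase i₀).card : ℝ) + 1 = B.card := by
    exact_mod_cast Finset.card_erase_add_one (h.1 hi₀)
  set k : ℝ := (B.card : ℝ)
  have hk0 : 0 < k := Nat.cast_pos.2 (Finset.card_pos.2 ⟨i₀, h.1 hi₀⟩)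
  let a : (Fin N → Bool) → ℝ := fun c => 1 + ((survivors (B.erase i₀) c).card : ℝ)
  let j : Equiv.Perm (Fin N) → ℝ := fun σ => contacts τ B (K.others \ B) σ
  have hd0 : (0 : ℝ) ≤ d := d.2.1
  have ha_mean : 1 - (∫ c, a c ∂coinLaw (Fin N) d) / (2 * k) ≤ (1 + d) / 2 := by
    rw [integral_add .of_finite .of_finite, integral_card_survivors, integral_const,
      probReal_univ, one_smul, sub_le_comm, le_div_iff₀ (by positivity), ← herase]
    linarith
  have ha_inv : ∫ c, (a c)⁻¹ ∂coinLaw (Fin N) d ≤ (1 - d : ℝ)⁻¹ * k⁻¹ := by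
    rw [← mul_inv, ← herase]
    exact integral_inv_one_add_card_survivors_le d (B.erase i₀) hd
  set μ := (∫ σ, j σ ∂seatingLaw N) / k
  obtain ⟨hμ, hμ1⟩ : μ ∈ Set.Icc (1 / 4) 1 :=
    h.integral_contacts_mem_Icc (fun p => (hτ p).1) ⟨i₀, h.1 hi₀⟩ hA hB
  calc ∫ o, ((K.nextBelievers 1 r B o).card : ℝ)⁻¹ ∂roundLaw N d
    _ ≤ ∫ o, ((1 - j o.1 / k) * (a o.2)⁻¹ + j o.1 / k * (k⁻¹ * (1 - a o.2 / (2 * k))))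
          ∂roundLaw N d :=
      integral_mono .of_finite .of_finite
        fun o => h.inv_card_nextBelievers_le (fun p => (hτ p).2) hi₀ o
    _ = (1 - μ) * (∫ c, (a c)⁻¹ ∂coinLaw (Fin N) d) +
          μ * (k⁻¹ * (1 - (∫ c, a c ∂coinLaw (Fin N) d) / (2 * k))) := by
      rw [integral_add .of_finite .of_finite, roundLaw_eq,
        integral_prod_mul (fun σ => 1 - j σ / k) (fun c => (a c)⁻¹),
        integral_prod_mul (fun σ => j σ / k) (fun c => k⁻¹ * (1 - a c / (2 * k))),
        integral_sub .of_finite .of_finite, integral_div, integral_const_mul,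
        integral_sub .of_finite .of_finite, integral_div]
      simp only [integral_const, probReal_univ, one_smul, μ]
    _ ≤ (1 - μ) * ((1 - d : ℝ)⁻¹ * k⁻¹) + μ * (k⁻¹ * ((1 + d) / 2)) := by
      have : 0 ≤ 1 - μ := sub_nonneg.2 hμ1
      have : 0 ≤ μ := by linarith
      gcongr
    _ = ((1 - μ) * (1 - d : ℝ)⁻¹ + μ * ((1 + d) / 2)) * k⁻¹ := by ring
    _ ≤ takeOverRate d * k⁻¹ := by
      gcongr
      exact one_sub_mul_inv_add_mul_le_takeOverRate hd0 hd hμ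

end Growth

section RoomPairs

variable {N r : ℕ} (B : Finset (Fin N))

/-- The ordered pairs of different seats in the same room. -/
def roomPairs (N r : ℕ) : Finset (Fin N × Fin N) :=
  Finset.univ.filter fun e => e.1 ≠ e.2 ∧ (e.1 : ℕ) / r = e.2 / r

/-- The event that both seats of the pair `e` are taken by members of `B`. -/
abbrev Meet (e : Fin N × Fin N) (σ : Equiv.Perm (Fin N)) : Prop :=
  σ.symm e.1 ∈ B ∧ σ.symm e.2 ∈ B

/-- The number of ordered pairs of different members of `B` in the same room. -/
def meetings (r : ℕ) (B : Finset (Fin N)) (σ : Equiv.Perm (Fin N)) : ℕ :=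
  ((roomPairs N r).filter fun e => Meet B e σ).card

theorem card_roomPairs_le (hr : 0 < r) : (roomPairs N r).card ≤ N * r := by
  have hfiber (p : Fin N) : ((roomPairs N r).filter fun e => e.1 = p).card ≤ r := by
    refine le_trans (Finset.card_le_card_of_injOn Prod.snd (fun e he => ?_) fun e he e' he' h => ?_)
      (card_seats_of_room_le (N := N) hr (p / r))
    · obtain ⟨hpair, rfl⟩ := Finset.mem_filter.1 he
      exact Finset.mem_filter.2 ⟨Finset.mem_univ _, (Finset.mem_filter.1 hpair).2.2.symm⟩
    · exact Prod.ext ((Finset.mem_filter.1 he).2.trans (Finset.mem_filter.1 he').2.symm) h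
  calc (roomPairs N r).card
    _ = ∑ p, ((roomPairs N r).filter fun e => e.1 = p).card :=
      Finset.card_eq_sum_card_fiberwise fun e _ => Finset.mem_coe.2 (Finset.mem_univ e.1)
    _ ≤ N * r := (Finset.sum_le_card_nsmul _ _ r fun p _ => hfiber p).trans (by simp)

theorem card_roomPairs_same_room_le (hr : 0 < r) (k : ℕ) :
    ((roomPairs N r).filter fun e => (e.1 : ℕ) / r = k).card ≤ r ^ 2 := by
  let seats := Finset.univ.filter fun p : Fin N => (p : ℕ) / r = k
  have hsub : ((roomPairs N r).filter fun e => (e.1 : ℕ) / r = k) ⊆ seats ×ˢ seats := by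
    intro e he
    obtain ⟨he, hk⟩ := Finset.mem_filter.1 he
    refine Finset.mem_product.2 ⟨Finset.mem_filter.2 ⟨Finset.mem_univ _, hk⟩, ?_⟩
    exact Finset.mem_filter.2 ⟨Finset.mem_univ _, (Finset.mem_filter.1 he).2.2.symm.trans hk⟩
  refine (Finset.card_le_card hsub).trans ?_
  rw [Finset.card_product, sq]
  exact Nat.mul_le_mul (card_seats_of_room_le hr k) (card_seats_of_room_le hr k)

theorem card_filter_two_le_believersInRoom_le (hr : 0 < r) (σ : Equiv.Perm (Fin N)) :
    (Finset.univ.filter fun i => 2 ≤ believersInRoom r B σ i).card ≤ meetings r B σ * r := by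
  have hsub : (Finset.univ.filter fun i => 2 ≤ believersInRoom r B σ i) ⊆
      ((roomPairs N r).filter fun e => Meet B e σ).biUnion fun e =>
        Finset.univ.filter fun i => room r σ i = (e.1 : ℕ) / r := by
    intro i hi
    obtain ⟨j, hj, j', hj', hne⟩ := Finset.one_lt_card.1 (Finset.mem_filter.1 hi).2
    obtain ⟨hjB, hji⟩ := Finset.mem_filter.1 hj
    obtain ⟨hjB', hji'⟩ := Finset.mem_filter.1 hj'
    have hpair : (σ j, σ j') ∈ roomPairs N r :=
      Finset.mem_filter.2 ⟨Finset.mem_univ _, σ.injective.ne hne, hji.trans hji'.symm⟩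
    have hmeet : Meet B (σ j, σ j') σ := by simpa [Meet] using ⟨hjB, hjB'⟩
    exact Finset.mem_biUnion.2 ⟨(σ j, σ j'), Finset.mem_filter.2 ⟨hpair, hmeet⟩,
      Finset.mem_filter.2 ⟨Finset.mem_univ _, hji.symm⟩⟩
  exact (Finset.card_le_card hsub).trans
    (Finset.card_biUnion_le_card_mul _ _ _ fun e _ => card_agents_of_room_le hr _ _)

theorem meetings_eq_sum (σ : Equiv.Perm (Fin N)) :
    (meetings r B σ : ℝ) = ∑ e ∈ roomPairs N r, if Meet B e σ then 1 else 0 := by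
  rw [Finset.sum_boole, meetings]

theorem integral_meet {e : Fin N × Fin N} (he : e.1 ≠ e.2) :
    ∫ σ, (if Meet B e σ then (1 : ℝ) else 0) ∂seatingLaw N = seatProb N B.card 2 := by
  have hmeet (σ : Equiv.Perm (Fin N)) :
      Meet B e σ ↔ ∀ i, σ.symm (Function.Embedding.embFinTwo he i) ∈ B :=
    (Fin.forall_fin_two (p := fun i => σ.symm (Function.Embedding.embFinTwo he i) ∈ B)).symm
  simp only [hmeet, integral_seatingLaw_forall_mem]

theorem integral_meet_and_meet {e e' : Fin N × Fin N}
    (h : Function.Injective ![e.1, e.2, e'.1, e'.2]) :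
    ∫ σ, (if Meet B e σ ∧ Meet B e' σ then (1 : ℝ) else 0) ∂seatingLaw N =
      seatProb N B.card 4 := by
  have hmeet (σ : Equiv.Perm (Fin N)) : Meet B e σ ∧ Meet B e' σ ↔
      ∀ i, σ.symm ((⟨![e.1, e.2, e'.1, e'.2], h⟩ : Fin 4 ↪ Fin N) i) ∈ B := by
    simp [Meet, Fin.forall_fin_succ, and_assoc]
  simp only [hmeet, integral_seatingLaw_forall_mem]

theorem integral_meet_and_meet_le {e e' : Fin N × Fin N} (he : e ∈ roomPairs N r)
    (he' : e' ∈ roomPairs N r) :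
    ∫ σ, (if Meet B e σ ∧ Meet B e' σ then (1 : ℝ) else 0) ∂seatingLaw N ≤
      seatProb N B.card 2 ^ 2 + if (e'.1 : ℕ) / r = e.1 / r then 1 else 0 := by
  obtain ⟨hne, hroom⟩ := (Finset.mem_filter.1 he).2
  obtain ⟨hne', hroom'⟩ := (Finset.mem_filter.1 he').2
  split_ifs with hnear
  · have hle : ∫ σ, (if Meet B e σ ∧ Meet B e' σ then (1 : ℝ) else 0) ∂seatingLaw N ≤ 1 := by
      refine (integral_mono .of_finite .of_finite (g := fun _ => (1 : ℝ)) fun σ => ?_).trans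
        (by simp)
      dsimp only
      split_ifs <;> norm_num
    exact hle.trans (le_add_of_nonneg_left (sq_nonneg _))
  · have hinj : Function.Injective ![e.1, e.2, e'.1, e'.2] := by
      have hdiff {p q : Fin N} (hp : (p : ℕ) / r = e.1 / r) (hq : (q : ℕ) / r = e'.1 / r) :
          p ≠ q := by
        rintro rfl
        exact hnear (hq.symm.trans hp)
      have h1 : e.1 ≠ e'.1 := hdiff rfl rfl
      have h2 : e.1 ≠ e'.2 := hdiff rfl hroom'.symm
      have h3 : e.2 ≠ e'.1 := hdiff hroom.symm rfl
      have h4 : e.2 ≠ e'.2 := hdiff hroom.symm hroom'.symm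
      simp [Function.Injective, Fin.forall_fin_succ, hne, hne', h1, h2, h3, h4, hne.symm,
        hne'.symm, h1.symm, h2.symm, h3.symm, h4.symm]
    rw [integral_meet_and_meet B hinj, add_zero, sq]
    exact seatProb_add_le (card_finset_fin_le B) 2 2

theorem integral_meetings :
    ∫ σ, (meetings r B σ : ℝ) ∂seatingLaw N = (roomPairs N r).card * seatProb N B.card 2 := by
  simp only [meetings_eq_sum]
  rw [integral_finsetSum _ fun _ _ => .of_finite,
    Finset.sum_congr rfl fun e he => integral_meet B (Finset.mem_filter.1 he).2.1,
    Finset.sum_const, nsmul_eq_mul]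

theorem integral_meetings_le (hr : 0 < r) :
    ∫ σ, (meetings r B σ : ℝ) ∂seatingLaw N ≤ r * B.card ^ 2 / N := by
  have hpairs : ((roomPairs N r).card : ℝ) ≤ N * r := by exact_mod_cast card_roomPairs_le hr
  have hseats : seatProb N B.card 2 ≤ (B.card / N : ℝ) ^ 2 := by
    rw [sq, ← seatProb_one]
    exact seatProb_add_le (card_finset_fin_le B) 1 1
  calc ∫ σ, (meetings r B σ : ℝ) ∂seatingLaw N
    _ = (roomPairs N r).card * seatProb N B.card 2 := integral_meetings B
    _ ≤ N * r * (B.card / N : ℝ) ^ 2 := by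
      gcongr
      exact seatProb_nonneg _ _ _
    _ = r * B.card ^ 2 / N := by
      rcases eq_or_ne (N : ℝ) 0 with hN | hN
      · simp [hN]
      · field_simp

theorem integral_sq_meetings_le (hr : 0 < r) :
    ∫ σ, (meetings r B σ : ℝ) ^ 2 ∂seatingLaw N ≤
      (roomPairs N r).card * ((roomPairs N r).card * seatProb N B.card 2 ^ 2 + r ^ 2) := by
  have hsq (σ : Equiv.Perm (Fin N)) : (meetings r B σ : ℝ) ^ 2 = ∑ e ∈ roomPairs N r,
      ∑ e' ∈ roomPairs N r, if Meet B e σ ∧ Meet B e' σ then 1 else 0 := by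
    simp only [meetings_eq_sum, sq, Finset.sum_mul_sum, ite_zero_mul_ite_zero, mul_one]
  have hnear (e : Fin N × Fin N) : ∑ e' ∈ roomPairs N r,
      (if (e'.1 : ℕ) / r = e.1 / r then (1 : ℝ) else 0) ≤ r ^ 2 := by
    rw [Finset.sum_boole]
    exact_mod_cast card_roomPairs_same_room_le hr _
  simp only [hsq]
  rw [integral_finsetSum _ fun _ _ => .of_finite, ← nsmul_eq_mul]
  refine Finset.sum_le_card_nsmul _ _ _ fun e he => ?_
  rw [integral_finsetSum _ fun _ _ => .of_finite]
  calc ∑ e' ∈ roomPairs N r,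
        ∫ σ, (if Meet B e σ ∧ Meet B e' σ then (1 : ℝ) else 0) ∂seatingLaw N
    _ ≤ ∑ e' ∈ roomPairs N r,
          (seatProb N B.card 2 ^ 2 + if (e'.1 : ℕ) / r = e.1 / r then 1 else 0) :=
      Finset.sum_le_sum fun e' he' => integral_meet_and_meet_le B he he'
    _ ≤ _ := by
      rw [Finset.sum_add_distrib, Finset.sum_const, nsmul_eq_mul]
      exact add_le_add_right (hnear e) _

theorem variance_meetings_le (hr : 0 < r) :
    Var[fun σ => (meetings r B σ : ℝ); seatingLaw N] ≤ N * r ^ 3 := by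
  have hpairs : ((roomPairs N r).card : ℝ) ≤ N * r := by exact_mod_cast card_roomPairs_le hr
  have hsecond := integral_sq_meetings_le B hr
  rw [variance_eq_sub .of_discrete, integral_meetings]
  simp only [Pi.pow_apply]
  calc _ ≤ (roomPairs N r).card * (r : ℝ) ^ 2 := by linarith
    _ ≤ N * r * r ^ 2 := by gcongr
    _ = N * r ^ 3 := by ring

theorem real_le_meetings_le (hr : 0 < r) {a : ℝ} (ha : 0 < a) :
    (seatingLaw N).real {σ | r * B.card ^ 2 / N + a ≤ (meetings r B σ : ℝ)} ≤
      N * r ^ 3 / a ^ 2 :=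
  real_ge_add_le_div_sq .of_discrete (integral_meetings_le B hr) (variance_meetings_le B hr) ha

end RoomPairs

section OneBeliever

variable {r s : ℕ} {d : unitInterval}

theorem aas_takenOverAt (hr : 1 < r) (hs : 1 ≤ s) (hd : (d : ℝ) < 1)
    (hd8 : 8 * (d : ℝ) < 1 + (d : ℝ) ^ 2) (init : ℕ → ℕ → Prop) :
    AAS r s d init fun {N} K B₀ ω => ∃ t : ℕ,
      (t : ℝ) ≤ 2 / (1 - takeOverRate d) * Real.log N ∧ K.TakenOverAt 1 r B₀ ω t := by
  intro ε hε
  have hlim := tendsto_const_div_atTop_nhds_zero_nat (𝕜 := ℝ) (Real.exp 1)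
  filter_upwards [hlim.eventually_le_const hε, eventually_ge_atTop 1] with N hN hN1 b K B₀ hK _
  have hN1' : (1 : ℝ) ≤ N := Nat.one_le_cast.2 hN1
  have hseeds : K.seeds.Nonempty := Finset.card_pos.1 (hs.trans_eq hK.card_seeds.symm)
  have hA : (K.agnostics.card : ℝ) ≤ 0.25 * N := by
    rw [hK.card_agnostics]
    exact mul_le_mul_of_nonneg_right hK.b_le (Nat.cast_nonneg N)
  have hcard {B : Finset (Fin N)} (hB : K.IsBelieverSet B) : (1 : ℝ) ≤ B.card :=
    Nat.one_le_cast.2 (hseeds.mono hB.1).card_pos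
  have hmain := one_sub_le_real_chain_hits_log (roundLaw N d) (step := K.nextBelievers 1 r)
    (D := {B | (N : ℝ) / 2 ≤ B.card}) (G := {B | K.IsBelieverSet B})
    (φ := fun B => N * (B.card : ℝ)⁻¹) (takeOverRate_nonneg d) (takeOverRate_lt_one hd hd8)
    le_rfl (fun B => by positivity)
    (fun B hB _ => by
      rw [← div_eq_mul_inv, one_le_div (by linarith [hcard hB])]
      exact_mod_cast card_finset_fin_le B)
    (fun B hB hBD => by
      rw [integral_const_mul, mul_left_comm]
      exact mul_le_mul_of_nonneg_left
        (hB.integral_inv_card_nextBelievers_le hd hr hK.rooms hseeds hA (not_le.1 hBD))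
        (Nat.cast_nonneg N))
    (fun B _ _ => by simp [Community.isBelieverSet_nextBelievers])
    hK.isBelieverSet hN1'
    (mul_le_of_le_one_right (Nat.cast_nonneg N) (inv_le_one_of_one_le₀ (hcard hK.isBelieverSet)))
  rw [mul_zero, add_zero] at hmain
  simp only [Community.TakenOverAt, believers_eq_chain]
  exact (sub_le_sub_left hN 1).trans hmain

theorem Community.TakenOverAt.log_le {N m : ℕ} {K : Community N} {B₀ : Finset (Fin N)}
    {ω : ℕ → RoundOutcome N} {t : ℕ} (ht : K.TakenOverAt m r B₀ ω t) (h : K.IsBelieverSet B₀)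
    (hr : 1 < r) (hm : 1 ≤ m) (hN0 : 0 < N) (hN : (2 * B₀.card) ^ 2 ≤ N) :
    1 / (2 * Real.log r) * Real.log N ≤ t := by
  have hlogr : 0 < Real.log r := Real.log_pos (Nat.one_lt_cast.2 hr)
  have hhalf : (N : ℝ) / 2 ≤ (K.believers m r B₀ ω t).card := ht
  have hgrowth : ((K.believers m r B₀ ω t).card : ℝ) ≤ B₀.card * (r : ℝ) ^ t := by
    exact_mod_cast h.card_believers_le_mul_pow (by lia) hm ω t
  have hsq : (N : ℝ) * N ≤ N * (r : ℝ) ^ (2 * t) := by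
    calc (N : ℝ) * N = (N : ℝ) ^ 2 := (sq _).symm
      _ ≤ (2 * B₀.card * (r : ℝ) ^ t) ^ 2 := by
        gcongr
        linarith
      _ = (2 * B₀.card) ^ 2 * (r : ℝ) ^ (2 * t) := by ring
      _ ≤ N * (r : ℝ) ^ (2 * t) := by
        gcongr
        exact_mod_cast hN
  have hlog := Real.log_le_log (by positivity) (le_of_mul_le_mul_left hsq (by positivity))
  rw [Real.log_pow] at hlog
  push_cast at hlog
  rw [one_div, inv_mul_le_iff₀ (by positivity)]
  linarith

theorem aas_le_of_takenOverAt {m : ℕ} (hr : 1 < r) (hm : 1 ≤ m) (k : ℕ) :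
    AAS r s d (fun _ N₀ => N₀ = k) fun {N} K B₀ ω => ∀ t : ℕ,
      K.TakenOverAt m r B₀ ω t → 1 / (2 * Real.log r) * Real.log N ≤ t := by
  intro ε hε
  filter_upwards [eventually_ge_atTop ((2 * k) ^ 2), eventually_gt_atTop 0]
    with N hN hN0 b K B₀ hK hB₀
  have huniv : {ω | ∀ t : ℕ, K.TakenOverAt m r B₀ ω t →
      1 / (2 * Real.log r) * Real.log N ≤ t} = Set.univ :=
    Set.eq_univ_of_forall fun ω t ht => ht.log_le hK.isBelieverSet hr hm hN0 (hB₀ ▸ hN)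
  rw [huniv, probReal_univ]
  linarith

end OneBeliever

section TwoBelievers

variable {N m r : ℕ} {K : Community N} {B : Finset (Fin N)} {d : unitInterval} {α : ℝ}

theorem Community.card_nextBelievers_sdiff_seeds_le (K : Community N) (B : Finset (Fin N))
    (hr : 0 < r) (hm : 2 ≤ m) (o : RoundOutcome N) :
    (K.nextBelievers m r B o \ K.seeds).card ≤
      (survivors (B \ K.seeds) o.2).card + meetings r B o.1 * r := by
  have hsub : K.nextBelievers m r B o \ K.seeds ⊆ survivors (B \ K.seeds) o.2 ∪
      Finset.univ.filter fun i => 2 ≤ believersInRoom r B o.1 i := by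
    intro i hi
    obtain ⟨hi, his⟩ := Finset.mem_sdiff.1 hi
    have hnew := (Finset.mem_union.1 hi).resolve_left his
    rcases (Finset.mem_filter.1 hnew).2 with ⟨hiB, hcoin⟩ | ⟨-, hroom⟩
    · exact Finset.mem_union_left _
        (Finset.mem_filter.2 ⟨Finset.mem_sdiff.2 ⟨hiB, his⟩, hcoin⟩)
    · exact Finset.mem_union_right _ (Finset.mem_filter.2 ⟨Finset.mem_univ _, hm.trans hroom⟩)
  refine (Finset.card_le_card hsub).trans ((Finset.card_union_le _ _).trans ?_)
  exact Nat.add_le_add_left (card_filter_two_le_believersInRoom_le B hr o.1) _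

theorem Community.integral_card_nextBelievers_sdiff_seeds_le (K : Community N)
    (B : Finset (Fin N)) (d : unitInterval) (hr : 0 < r) (hm : 2 ≤ m) :
    ∫ o, ((K.nextBelievers m r B o \ K.seeds).card : ℝ) ∂roundLaw N d ≤
      (1 - d : ℝ) * (B \ K.seeds).card + r ^ 2 * B.card ^ 2 / N := by
  calc ∫ o, ((K.nextBelievers m r B o \ K.seeds).card : ℝ) ∂roundLaw N d
    _ ≤ ∫ o, (((survivors (B \ K.seeds) o.2).card : ℝ) + meetings r B o.1 * r) ∂roundLaw N d :=
      integral_mono .of_finite .of_finite fun o => by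
        dsimp only
        exact_mod_cast K.card_nextBelievers_sdiff_seeds_le B hr hm o
    _ = (1 - d : ℝ) * (B \ K.seeds).card +
          (∫ σ, (meetings r B σ : ℝ) ∂seatingLaw N) * r := by
      rw [integral_add .of_finite .of_finite, integral_mul_const, roundLaw_eq,
        integral_fun_snd (fun c => ((survivors (B \ K.seeds) c).card : ℝ)),
        integral_fun_fst (fun σ => (meetings r B σ : ℝ)), integral_card_survivors,
        probReal_univ, probReal_univ, one_smul, one_smul]
    _ ≤ (1 - d : ℝ) * (B \ K.seeds).card + r * B.card ^ 2 / N * r := by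
      gcongr
      exact integral_meetings_le B hr
    _ = _ := by ring

theorem Community.IsBelieverSet.one_le_card_sdiff_seeds (h : K.IsBelieverSet B)
    (hne : B ≠ K.seeds) : 1 ≤ (B \ K.seeds).card :=
  (Finset.sdiff_nonempty.2 fun hsub => hne (hsub.antisymm h.1)).card_pos

theorem Community.IsBelieverSet.integral_card_nextBelievers_sdiff_seeds_le_mul
    (h : K.IsBelieverSet B) (hr : 0 < r) (hm : 2 ≤ m) (hα : (r : ℝ) ^ 2 * α ≤ d / 8) (hN : 0 < N)
    (hseeds : 8 * (r : ℝ) ^ 2 * K.seeds.card ^ 2 ≤ d * N) (hne : B ≠ K.seeds)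
    (hB : (B.card : ℝ) ≤ α * N) :
    ∫ o, ((K.nextBelievers m r B o \ K.seeds).card : ℝ) ∂roundLaw N d ≤
      (1 - d / 2 : ℝ) * (B \ K.seeds).card := by
  refine (K.integral_card_nextBelievers_sdiff_seeds_le B d hr hm).trans ?_
  have hN' : (0 : ℝ) < N := Nat.cast_pos.2 hN
  have hd0 : (0 : ℝ) ≤ d := d.2.1
  have hone : (1 : ℝ) ≤ (B \ K.seeds).card := Nat.one_le_cast.2 (h.one_le_card_sdiff_seeds hne)
  have hcard : ((B \ K.seeds).card : ℝ) + K.seeds.card = B.card := by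
    exact_mod_cast Finset.card_sdiff_add_card_eq_card h.1
  set s : ℝ := (K.seeds.card : ℝ)
  set y : ℝ := ((B \ K.seeds).card : ℝ)
  have hy : (r : ℝ) ^ 2 * y ≤ d / 8 * N :=
    calc (r : ℝ) ^ 2 * y ≤ r ^ 2 * (α * N) := by
          gcongr
          linarith [Nat.cast_nonneg (α := ℝ) K.seeds.card]
      _ ≤ (d : ℝ) / 8 * N := by
          rw [← mul_assoc]
          gcongr
  have hmeetings : (r : ℝ) ^ 2 * B.card ^ 2 / N ≤ d / 2 * y := by
    rw [div_le_iff₀ hN', ← hcard]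
    calc (r : ℝ) ^ 2 * (y + s) ^ 2 ≤ r ^ 2 * (2 * (y ^ 2 + s ^ 2)) := by
          gcongr
          exact add_sq_le
      _ = 2 * (r ^ 2 * y) * y + 2 * r ^ 2 * s ^ 2 := by ring
      _ ≤ 2 * (d / 8 * N) * y + d / 4 * N * y := by
          refine add_le_add (by gcongr) ?_
          have : (d : ℝ) / 4 * N ≤ d / 4 * N * y := le_mul_of_one_le_right (by positivity) hone
          linarith
      _ = d / 2 * y * N := by ring
  linarith

theorem Community.card_nextBelievers_le (K : Community N) (B : Finset (Fin N)) (hr : 0 < r)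
    (hm : 2 ≤ m) (o : RoundOutcome N) :
    (K.nextBelievers m r B o).card ≤
      K.seeds.card + ((survivors B o.2).card + meetings r B o.1 * r) := by
  have hsplit : (K.nextBelievers m r B o \ K.seeds).card + K.seeds.card =
      (K.nextBelievers m r B o).card := Finset.card_sdiff_add_card_eq_card Finset.subset_union_left
  have hsurv : (survivors (B \ K.seeds) o.2).card ≤ (survivors B o.2).card :=
    Finset.card_le_card (Finset.filter_subset_filter _ Finset.sdiff_subset)
  have hnew := K.card_nextBelievers_sdiff_seeds_le B hr hm o
  lia

theorem Community.card_nextBelievers_le_mul_of_le (K : Community N) (hr : 0 < r) (hm : 2 ≤ m)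
    (hα : (r : ℝ) ^ 2 * α ≤ d / 8) (hα0 : 0 ≤ α) (hN : 0 < N)
    (hseeds : 8 * (K.seeds.card : ℝ) ≤ d * α * N) (hB : (B.card : ℝ) ≤ α * N)
    {o : RoundOutcome N}
    (hsurv : ((survivors B o.2).card : ℝ) ≤ (1 - d) * B.card + d * α * N / 4)
    (hmeet : (meetings r B o.1 : ℝ) ≤ r * B.card ^ 2 / N + d * α * N / 4 / r) :
    ((K.nextBelievers m r B o).card : ℝ) ≤ α * N := by
  have hd1 : (0 : ℝ) ≤ 1 - d := sub_nonneg.2 d.2.2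
  have hN' : (0 : ℝ) < N := Nat.cast_pos.2 hN
  have : (0 : ℝ) < r := Nat.cast_pos.2 hr
  have hstay : (1 - d : ℝ) * B.card ≤ (1 - d) * (α * N) := by gcongr
  have hpairs : (r : ℝ) ^ 2 * B.card ^ 2 / N ≤ d * α * N / 8 := by
    rw [div_le_iff₀ hN']
    calc (r : ℝ) ^ 2 * B.card ^ 2 ≤ r ^ 2 * (α * N) ^ 2 := by gcongr
      _ = r ^ 2 * α * (α * N ^ 2) := by ring
      _ ≤ (d : ℝ) / 8 * (α * N ^ 2) := by gcongr
      _ = d * α * N / 8 * N := by ring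
  have hnew : (meetings r B o.1 : ℝ) * r ≤ d * α * N / 8 + d * α * N / 4 :=
    calc (meetings r B o.1 : ℝ) * r
      _ ≤ (r * B.card ^ 2 / N + d * α * N / 4 / r) * r := by gcongr
      _ = r ^ 2 * B.card ^ 2 / N + d * α * N / 4 := by field_simp
      _ ≤ _ := by gcongr
  have : 0 ≤ (d : ℝ) * α * N := by
    have := d.2.1
    positivity
  calc ((K.nextBelievers m r B o).card : ℝ)
    _ ≤ K.seeds.card + ((survivors B o.2).card + meetings r B o.1 * r) := by
      exact_mod_cast K.card_nextBelievers_le B hr hm o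
    _ ≤ α * N := by linarith

theorem Community.real_mul_lt_card_nextBelievers_le (K : Community N) (hr : 0 < r) (hm : 2 ≤ m)
    (hd : (0 : ℝ) < d) (hα : (r : ℝ) ^ 2 * α ≤ d / 8) (hα0 : 0 < α) (hN : 0 < N)
    (hseeds : 8 * (K.seeds.card : ℝ) ≤ d * α * N) (hB : (B.card : ℝ) ≤ α * N) :
    (roundLaw N d).real {o | α * N < ((K.nextBelievers m r B o).card : ℝ)} ≤
      16 * (1 + r ^ 5) / (d * α) ^ 2 / N := by
  have : (0 : ℝ) < N := Nat.cast_pos.2 hN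
  have : (0 : ℝ) < r := Nat.cast_pos.2 hr
  set a : ℝ := d * α * N / 4 with ha
  have ha0 : 0 < a := by positivity
  let manySurvivors : Set (Fin N → Bool) :=
    {c | (1 - d : ℝ) * B.card + a ≤ ((survivors B c).card : ℝ)}
  let manyMeetings : Set (Equiv.Perm (Fin N)) :=
    {σ | r * B.card ^ 2 / N + a / r ≤ (meetings r B σ : ℝ)}
  have hsub : {o | α * N < ((K.nextBelievers m r B o).card : ℝ)} ⊆
      Set.univ ×ˢ manySurvivors ∪ manyMeetings ×ˢ Set.univ := by
    intro o ho
    by_contra hno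
    simp only [Set.mem_union, Set.mem_prod, Set.mem_univ, true_and, and_true, not_or] at hno
    exact (K.card_nextBelievers_le_mul_of_le hr hm hα hα0.le hN hseeds hB
      (not_le.1 hno.1).le (not_le.1 hno.2).le).not_gt ho
  have hsurv : (coinLaw (Fin N) d).real manySurvivors ≤ N / a ^ 2 :=
    (real_le_card_survivors_le d B ha0).trans (by gcongr; exact card_finset_fin_le B)
  have hmeet : (seatingLaw N).real manyMeetings ≤ N * r ^ 3 / (a / r) ^ 2 :=
    real_le_meetings_le B hr (by positivity)
  calc (roundLaw N d).real {o | α * N < ((K.nextBelievers m r B o).card : ℝ)}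
    _ ≤ (roundLaw N d).real (Set.univ ×ˢ manySurvivors) +
          (roundLaw N d).real (manyMeetings ×ˢ Set.univ) :=
      (measureReal_mono hsub).trans (measureReal_union_le _ _)
    _ ≤ N / a ^ 2 + N * r ^ 3 / (a / r) ^ 2 := by
      simp only [roundLaw_eq, measureReal_prod_prod, probReal_univ, one_mul, mul_one]
      exact add_le_add hsurv hmeet
    _ = 16 * (1 + r ^ 5) / (d * α) ^ 2 / N := by
      rw [ha]
      field_simp
      ring

theorem tendsto_const_div_add_const_mul_log_div (a b : ℝ) :
    Tendsto (fun N : ℕ => a / N + b * (Real.log N / N)) atTop (nhds 0) := by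
  have hlog : Tendsto (fun N : ℕ => Real.log N / N) atTop (nhds 0) :=
    Real.isLittleO_log_id_atTop.tendsto_div_nhds_zero.comp tendsto_natCast_atTop_atTop
  simpa only [mul_zero, add_zero] using
    (tendsto_const_div_atTop_nhds_zero_nat a).add (hlog.const_mul b)

theorem aas_diedOutAt {s : ℕ} (hm : 2 ≤ m) (hd : (0 : ℝ) < d) (hα0 : 0 < α)
    (hα : (r : ℝ) ^ 2 * α ≤ d / 8) :
    AAS r s d (fun N N₀ => (N₀ : ℝ) ≤ α * N) fun {N} K B₀ ω => ∃ t : ℕ,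
      (t : ℝ) ≤ 4 / d * Real.log N ∧ K.DiedOutAt m r B₀ ω t := by
  intro ε hε
  set H : ℝ := 16 * (1 + r ^ 5) / (d * α) ^ 2
  have hlim := tendsto_const_div_add_const_mul_log_div (Real.exp 1) (4 / d * H)
  have hlarge {a : ℝ} (ha : 0 < a) (b : ℝ) : ∀ᶠ N : ℕ in atTop, b ≤ a * N :=
    (tendsto_natCast_atTop_atTop.const_mul_atTop ha).eventually_ge_atTop b
  filter_upwards [hlim.eventually_le_const hε, eventually_gt_atTop 0,
    hlarge hd (8 * r ^ 2 * s ^ 2), hlarge (mul_pos hd hα0) (8 * s)]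
    with N hN hN0 hseeds_sq hseeds b K B₀ hK hB₀
  have hr : 0 < r := Nat.pos_of_dvd_of_pos hK.rooms hN0
  have hd1 : (d : ℝ) ≤ 1 := d.2.2
  rw [← hK.card_seeds] at hseeds_sq hseeds
  have hmain := one_sub_le_real_chain_hits_log (roundLaw N d) (step := K.nextBelievers m r)
    (D := {K.seeds}) (G := {B | K.IsBelieverSet B ∧ (B.card : ℝ) ≤ α * N})
    (φ := fun B => ((B \ K.seeds).card : ℝ)) (γ := 1 - d / 2) (η := H / N)
    (by linarith) (by linarith) (by positivity) (fun B => by positivity)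
    (fun B hB hne => Nat.one_le_cast.2 (hB.1.one_le_card_sdiff_seeds hne))
    (fun B hB hne =>
      hB.1.integral_card_nextBelievers_sdiff_seeds_le_mul hr hm hα hN0 hseeds_sq hne hB.2)
    (fun B hB _ => by
      simpa only [Set.mem_ofPred_eq, K.isBelieverSet_nextBelievers, true_and, not_le] using
        K.real_mul_lt_card_nextBelievers_le hr hm hd hα hα0 hN0 hseeds hB.2)
    ⟨hK.isBelieverSet, hB₀⟩ (Nat.one_le_cast.2 hN0)
    (Nat.cast_le.2 (card_finset_fin_le (B₀ \ K.seeds)))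
  have hrate : 2 / (1 - (1 - d / 2)) = (4 / d : ℝ) := by
    rw [sub_sub_cancel, div_div_eq_mul_div]
    norm_num
  rw [hrate] at hmain
  simp only [Community.DiedOutAt, believers_eq_chain]
  refine le_trans (sub_le_sub_left ?_ 1) hmain
  calc _ = Real.exp 1 / N + 4 / d * H * (Real.log N / N) := by ring
    _ ≤ ε := hN

end TwoBelievers

section Persistence

variable {N m r : ℕ} {d : unitInterval}

theorem real_chain_survivors_nonempty (d : unitInterval) (S : Finset (Fin N)) (T : ℕ) :
    (processLaw N d).real
        {ω | ∀ t ≤ T, chain (fun S o => survivors S o.2) S ω t ≠ ∅} =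
      1 - (1 - (1 - d : ℝ) ^ T) ^ S.card := by
  induction T generalizing S with
  | zero =>
    rcases S.eq_empty_or_nonempty with rfl | hS
    · simp [chain]
    · simp [chain, hS.ne_empty, hS.card_ne_zero]
  | succ T ih =>
    rcases S.eq_empty_or_nonempty with rfl | hS
    · have hempty : {ω : ℕ → RoundOutcome N | ∀ t ≤ T + 1,
          chain (fun S o => survivors S o.2) ∅ ω t ≠ ∅} = ∅ :=
        Set.eq_empty_of_forall_notMem fun ω h => h 0 (Nat.zero_le _) rfl
      rw [hempty, measureReal_empty, Finset.card_empty, pow_zero, sub_self]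
    · have hstep : _ = ∫ o, (processLaw N d).real {ω | ∀ t ≤ T,
          chain (fun S o => survivors S o.2) (survivors S o.2) ω t ≠ ∅} ∂roundLaw N d :=
        real_chain_avoids_succ (roundLaw N d) _ (D := {∅}) hS.ne_empty T
      refine hstep.trans ?_
      simp only [ih]
      rw [integral_sub .of_finite .of_finite, roundLaw_eq,
        integral_fun_snd (fun c => (1 - (1 - d : ℝ) ^ T) ^ (survivors S c).card),
        integral_pow_card_survivors]
      simp only [integral_const, probReal_univ, one_smul]
      ring

theorem one_sub_exp_le_real_chain_survivors_nonempty (d : unitInterval) (S : Finset (Fin N))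
    (T : ℕ) :
    1 - Real.exp (-(S.card * (1 - d : ℝ) ^ T)) ≤ (processLaw N d).real
      {ω | ∀ t ≤ T, chain (fun S o => survivors S o.2) S ω t ≠ ∅} := by
  have hq : (1 - d : ℝ) ^ T ≤ 1 := pow_le_one₀ (sub_nonneg.2 d.2.2) (sub_le_self 1 d.2.1)
  rw [real_chain_survivors_nonempty]
  refine sub_le_sub_left ?_ 1
  calc (1 - (1 - d : ℝ) ^ T) ^ S.card ≤ Real.exp (-(1 - d : ℝ) ^ T) ^ S.card :=
        pow_le_pow_left₀ (sub_nonneg.2 hq) (Real.one_sub_le_exp_neg _) _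
    _ = Real.exp (-(S.card * (1 - d : ℝ) ^ T)) := by rw [← Real.exp_nat_mul, mul_neg]

theorem Community.IsBelieverSet.chain_survivors_eq_empty {K : Community N} {B₀ : Finset (Fin N)}
    {ω : ℕ → RoundOutcome N} {t : ℕ} (h : K.IsBelieverSet B₀) (ht : K.DiedOutAt m r B₀ ω t) :
    chain (fun S o => survivors S o.2) (B₀ \ K.seeds) ω t = ∅ := by
  have hsub (t : ℕ) : chain (fun S o => survivors S o.2) (B₀ \ K.seeds) ω t ⊆ B₀ \ K.seeds := by
    induction t with
    | zero => exact subset_rfl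
    | succ t ih => exact (survivors_subset _ _).trans ih
  have hseeds : chain (fun S o => survivors S o.2) (B₀ \ K.seeds) ω t ⊆ K.seeds :=
    ht ▸ h.chain_survivors_subset_believers Finset.sdiff_subset ω t
  exact disjoint_self.1 (Finset.disjoint_sdiff.mono hseeds (hsub t))

theorem aas_le_of_diedOutAt {s : ℕ} (hd : (0 : ℝ) < d) (hd1 : (d : ℝ) < 1) {β : ℝ} (hβ : 0 < β) :
    AAS r s d (fun N N₀ => β * N ≤ (N₀ : ℝ)) fun {N} K B₀ ω => ∀ t : ℕ,
      K.DiedOutAt m r B₀ ω t → 1 / (-2 * Real.log (1 - d)) * Real.log N ≤ t := by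
  intro ε hε
  have hlim : Tendsto (fun N : ℕ => Real.exp (-(β * √N - s))) atTop (nhds 0) :=
    Real.tendsto_exp_neg_atTop_nhds_zero.comp <| tendsto_atTop_add_const_right _ _ <|
      (Real.tendsto_sqrt_atTop.comp tendsto_natCast_atTop_atTop).const_mul_atTop hβ
  filter_upwards [hlim.eventually_le_const hε, eventually_ge_atTop 1] with N hN hN1 b K B₀ hK hB₀
  have hN1' : (1 : ℝ) ≤ N := Nat.one_le_cast.2 hN1
  set T := ⌊1 / (-2 * Real.log (1 - d)) * Real.log N⌋₊
  have hcard : β * N - s ≤ (B₀ \ K.seeds).card := by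
    have : ((B₀ \ K.seeds).card : ℝ) + s = B₀.card := by
      rw [← hK.card_seeds]
      exact_mod_cast Finset.card_sdiff_add_card_eq_card hK.isBelieverSet.1
    linarith
  have hmany : β * √N - s ≤ (B₀ \ K.seeds).card * (1 - d : ℝ) ^ T := by
    have hinv : (√N : ℝ)⁻¹ ≤ 1 := inv_le_one_of_one_le₀ (Real.one_le_sqrt.2 hN1')
    calc β * √N - s ≤ β * √N - s * (√N)⁻¹ :=
          sub_le_sub_left (mul_le_of_le_one_right (Nat.cast_nonneg s) hinv) _
      _ = (β * N - s) * (√N)⁻¹ := by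
          rw [sub_mul, mul_assoc, ← div_eq_mul_inv (N : ℝ), Real.div_sqrt]
      _ ≤ (B₀ \ K.seeds).card * (√N)⁻¹ := by gcongr
      _ ≤ (B₀ \ K.seeds).card * (1 - d : ℝ) ^ T := by
          gcongr
          exact inv_sqrt_le_pow_floor_log (sub_pos.2 hd1) (sub_lt_self 1 hd) hN1'
  calc 1 - ε ≤ 1 - Real.exp (-((B₀ \ K.seeds).card * (1 - d : ℝ) ^ T)) :=
        sub_le_sub_left ((Real.exp_le_exp.2 (neg_le_neg hmany)).trans hN) 1
    _ ≤ (processLaw N d).real {ω | ∀ t ≤ T,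
          chain (fun S o => survivors S o.2) (B₀ \ K.seeds) ω t ≠ ∅} :=
        one_sub_exp_le_real_chain_survivors_nonempty d _ T
    _ ≤ _ := by
        refine measureReal_mono (fun ω hω t ht => ?_)
        refine (Nat.lt_of_floor_lt (not_le.1 fun hle => ?_)).le
        exact hω t hle (hK.isBelieverSet.chain_survivors_eq_empty ht)

end Persistence

end RumorSpreading

theorem theorem1_general (r : ℕ) (d : unitInterval) (hd_pos : (0 : ℝ) < d) (hd_lt : (d : ℝ) < 1) :
    (1 < r → 8 * (d : ℝ) < 1 + (d : ℝ) ^ 2 →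
      ∃ C > (0 : ℝ), ∃ c > (0 : ℝ), ∀ s : ℕ, 1 ≤ s →
        RumorSpreading.AAS r s d (fun _ N₀ => s ≤ N₀)
          (fun {N} K B₀ ω => ∃ t : ℕ, (t : ℝ) ≤ C * Real.log N ∧ K.TakenOverAt 1 r B₀ ω t) ∧
        RumorSpreading.AAS r s d (fun _ N₀ => N₀ = s)
          (fun {N} K B₀ ω => ∀ t : ℕ, K.TakenOverAt 1 r B₀ ω t → c * Real.log N ≤ (t : ℝ))) ∧
    (∃ α > (0 : ℝ), ∃ C > (0 : ℝ), ∃ c > (0 : ℝ), ∀ m s : ℕ, 2 ≤ m →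
        RumorSpreading.AAS r s d (fun N N₀ => (N₀ : ℝ) ≤ α * N)
          (fun {N} K B₀ ω => ∃ t : ℕ, (t : ℝ) ≤ C * Real.log N ∧ K.DiedOutAt m r B₀ ω t) ∧
        ∀ β > (0 : ℝ), RumorSpreading.AAS r s d (fun N N₀ => β * N ≤ (N₀ : ℝ))
          (fun {N} K B₀ ω => ∀ t : ℕ, K.DiedOutAt m r B₀ ω t → c * Real.log N ≤ (t : ℝ))) := by
  refine ⟨fun hr hd8 => ⟨2 / (1 - RumorSpreading.takeOverRate d), ?_, 1 / (2 * Real.log r), ?_,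
    fun s hs => ⟨RumorSpreading.aas_takenOverAt hr hs hd_lt hd8 _,
      RumorSpreading.aas_le_of_takenOverAt hr le_rfl s⟩⟩,
    d / (8 * (r + 1) ^ 2), by positivity, 4 / d, by positivity, 1 / (-2 * Real.log (1 - d)), ?_,
    fun m s hm => ⟨RumorSpreading.aas_diedOutAt hm hd_pos (by positivity) ?_,
      fun β hβ => RumorSpreading.aas_le_of_diedOutAt hd_pos hd_lt hβ⟩⟩
  · exact div_pos two_pos (sub_pos.2 (RumorSpreading.takeOverRate_lt_one hd_lt hd8))
  · have := Real.log_pos (Nat.one_lt_cast (α := ℝ).2 hr)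
    positivity
  · have := Real.log_neg (sub_pos.2 hd_lt) (sub_lt_self 1 hd_pos)
    exact one_div_pos.2 (by linarith)
  · rw [mul_div_assoc', div_le_div_iff₀ (by positivity) (by positivity)]
    nlinarith [Nat.cast_nonneg (α := ℝ) r]

theorem theorem1 (r : ℕ) (d : unitInterval) (hd_pos : (0 : ℝ) < d) (hd_le : (d : ℝ) ≤ 0.1) :
    -- one Believer in a room suffices
    (1 < r →
      ∃ C > (0 : ℝ), ∃ c > (0 : ℝ), ∀ s : ℕ, 1 ≤ s →
        -- take-over within `O(log N)` rounds
        RumorSpreading.AAS r s d (fun _ N₀ => s ≤ N₀)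
          (fun {N} K B₀ ω => ∃ t : ℕ, (t : ℝ) ≤ C * Real.log N ∧ K.TakenOverAt 1 r B₀ ω t) ∧
        -- tightness: no take-over before `Ω(log N)` rounds when only the Seeds believe initially
        RumorSpreading.AAS r s d (fun _ N₀ => N₀ = s)
          (fun {N} K B₀ ω => ∀ t : ℕ, K.TakenOverAt 1 r B₀ ω t → c * Real.log N ≤ (t : ℝ))) ∧
    -- at least two Believers in a room are needed
    (∃ α > (0 : ℝ), ∃ C > (0 : ℝ), ∃ c > (0 : ℝ), ∀ m s : ℕ, 2 ≤ m → m < r → m ≤ s →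
        -- extinction within `O(log N)` rounds
        RumorSpreading.AAS r s d (fun N N₀ => (N₀ : ℝ) ≤ α * N)
          (fun {N} K B₀ ω => ∃ t : ℕ, (t : ℝ) ≤ C * Real.log N ∧ K.DiedOutAt m r B₀ ω t) ∧
        -- tightness: no extinction before `Ω(log N)` rounds from a linear number of Believers
        ∀ β > (0 : ℝ), RumorSpreading.AAS r s d (fun N N₀ => β * N ≤ (N₀ : ℝ))
          (fun {N} K B₀ ω => ∀ t : ℕ, K.DiedOutAt m r B₀ ω t → c * Real.log N ≤ (t : ℝ))) := by
  obtain ⟨h₁, α, hα, C, hC, c, hc, h₂⟩ := theorem1_general r d hd_pos (by linarith)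
  exact ⟨fun hr => h₁ hr (by nlinarith), α, hα, C, hC, c, hc, fun m s hm _ _ => h₂ m s hm⟩
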